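/- Let $n\ge 2$ be an integer. For integers $a_1<a_2<\cdots<a_n$ put $\chi(x)=(x-a_1)\cdots(x-a_n)$, $R=\mathbb{Z}[x]/(\chi(x))$, $K=\mathbb{Q}\otimes_{\mathbb{Z}}R$ and $\Delta=\prod_{i<j}(a_j-a_i)$. A fractional $R$-ideal is an $R$-submodule of $K$ that is finitely generated of rank $n$ as a $\mathbb{Z}$-module; two fractional ideals $I,J$ are equivalent if $I=kJ$ for some $k\in K^\times$; the equivalence classes form a monoid under multiplication of ideals, and $\mathrm{Cl}(R)$ denotes its group of units. Let $\varphi$ be Euler's totient function. Then $\mathrm{Cl}(R)$ is always finite and, when $n$ is fixed and $\Delta\to\infty$ (over all choices of $a_1<\cdots<a_n$), $$\liminf_{\Delta\to\infty}\frac{|\mathrm{Cl}(R)|\cdot 2^{n-1}}{\varphi(\Delta)}=\begin{cases}1,& n=2,\\ 0,& n\ge 3,\end{cases}\qquad \limsup_{\Delta\to\infty}\frac{|\mathrm{Cl}(R)|\cdot 2^{n-1}}{\varphi(\Delta)}=\prod_{\substack{p\le n-2\\ p\text{ prime}}}\left(1-p^{-1}\right)^{n-1-p}.$$ -/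

import Mathlib

open Filter Polynomial
open scoped TensorProduct

noncomputable section

namespace OrderClassGroup

/-! ### Fractional ideals, ideal class monoid and ideal class group of a `ℤ`-order -/

section General

variable (R : Type) [CommRing R]

/-- The `ℚ`-algebra `K = ℚ ⊗_ℤ R`. -/
def TotalAlgebra : Type := ℚ ⊗[ℤ] R

instance commRingTotal : CommRing (TotalAlgebra R) := inferInstanceAs (CommRing (ℚ ⊗[ℤ] R))

instance algebraRatTotal : Algebra ℚ (TotalAlgebra R) := inferInstanceAs (Algebra ℚ (ℚ ⊗[ℤ] R))

/-- `K = ℚ ⊗_ℤ R` as an `R`-algebra, through `r ↦ 1 ⊗ r`. -/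
instance algebraTotal : Algebra R (TotalAlgebra R) :=
  RingHom.toAlgebra
    ((Algebra.TensorProduct.includeRight : R →ₐ[ℤ] ℚ ⊗[ℤ] R) : R →+* ℚ ⊗[ℤ] R)

instance finiteTotal [Module.Finite ℤ R] : Module.Finite ℚ (TotalAlgebra R) :=
  inferInstanceAs (Module.Finite ℚ (ℚ ⊗[ℤ] R))

variable {R}

/-- A fractional `R`-ideal: an `R`-submodule `I` of `K = ℚ ⊗_ℤ R` that is a finitely generated
`ℤ`-module of rank `dim_ℚ K`. -/
structure IsFractionalIdeal (I : Submodule R (TotalAlgebra R)) : Prop where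
  fg : (I.restrictScalars ℤ).FG
  rank : Module.finrank ℤ I = Module.finrank ℚ (TotalAlgebra R)

/-- A finitely generated `I` has full rank if and only if it spans `K` over `ℚ`. -/
theorem isFractionalIdeal_iff [Module.Finite ℤ R] (I : Submodule R (TotalAlgebra R)) :
    IsFractionalIdeal I ↔
      (I.restrictScalars ℤ).FG ∧ Submodule.span ℚ (I : Set (TotalAlgebra R)) = ⊤ := by
  constructor
  · rintro ⟨h1, h2⟩
    refine ⟨h1, ?_⟩
    have hfin : Module.Finite ℤ (I.restrictScalars ℤ) := Module.Finite.iff_fg.mpr h1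
    have h2' : Module.finrank ℤ (I.restrictScalars ℤ) = Module.finrank ℚ (TotalAlgebra R) := h2
    have h3 : Module.rank ℚ (TotalAlgebra R) ≤ Module.rank ℤ (I.restrictScalars ℤ) := by
      rw [← Module.finrank_eq_rank, ← Module.finrank_eq_rank, h2']
    have := Submodule.span_range_eq_top_of_injective_of_rank_le
      (K := ℚ) (I.restrictScalars ℤ).injective_subtype h3
    simpa using this
  · rintro ⟨h1, h2⟩
    have : Submodule.IsLattice ℚ (I.restrictScalars ℤ) := ⟨h1, h2⟩
    have h3 : Module.finrank ℤ (I.restrictScalars ℤ) = Module.finrank ℚ (TotalAlgebra R) :=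
      congrArg Cardinal.toNat (Submodule.IsLattice.rank' ℚ (I.restrictScalars ℤ))
    exact ⟨h1, h3⟩

variable (R)

/-- The commutative monoid of fractional `R`-ideals under multiplication of ideals. -/
def fractionalIdeals [Module.Finite ℤ R] : Submonoid (Submodule R (TotalAlgebra R)) where
  carrier := {I | IsFractionalIdeal I}
  one_mem' := by
    refine (isFractionalIdeal_iff _).2 ⟨?_, ?_⟩
    · have h1 : ((1 : Submodule R (TotalAlgebra R)).restrictScalars ℤ) =
          (⊤ : Submodule ℤ R).map (algebraMap R (TotalAlgebra R)).toAddMonoidHom.toIntLinearMap := by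
        ext x
        rw [Submodule.restrictScalars_mem, Submodule.mem_one, Submodule.mem_map]
        exact ⟨fun ⟨y, hy⟩ => ⟨y, trivial, hy⟩, fun ⟨y, _, hy⟩ => ⟨y, hy⟩⟩
      rw [h1]
      exact Module.Finite.fg_top.map _
    · rw [eq_top_iff]
      intro x _
      have key : ∀ x : ℚ ⊗[ℤ] R, @id (TotalAlgebra R) x ∈
          Submodule.span ℚ ((1 : Submodule R (TotalAlgebra R)) : Set (TotalAlgebra R)) := by
        intro x
        induction x using TensorProduct.induction_on with
        | zero => exact Submodule.zero_mem _
        | add x y hx hy => exact Submodule.add_mem _ hx hy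
        | tmul q r =>
          have h2 : q • ((1 : ℚ) ⊗ₜ[ℤ] r) = q ⊗ₜ[ℤ] r := by
            rw [TensorProduct.smul_tmul', smul_eq_mul, mul_one]
          rw [← h2]
          exact Submodule.smul_mem _ q
            (Submodule.subset_span (Submodule.mem_one.2 ⟨r, rfl⟩))
      exact key x
  mul_mem' {I J} hI hJ := by
    obtain ⟨hI1, hI2⟩ := (isFractionalIdeal_iff _).1 hI
    obtain ⟨hJ1, hJ2⟩ := (isFractionalIdeal_iff _).1 hJ
    refine (isFractionalIdeal_iff _).2 ⟨?_, ?_⟩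
    · have h1 : (I * J).restrictScalars ℤ = I.restrictScalars ℤ * J.restrictScalars ℤ :=
        Submodule.restrictScalars_mul
      rw [h1]
      exact hI1.mul hJ1
    · rw [eq_top_iff]
      have h2 : (⊤ : Submodule ℚ (TotalAlgebra R)) * ⊤ = ⊤ := by
        rw [eq_top_iff]
        intro x _
        simpa using Submodule.mul_mem_mul (Submodule.mem_top (R := ℚ) (x := x))
          (Submodule.mem_top (R := ℚ) (x := (1 : TotalAlgebra R)))
      rw [← h2]
      nth_rewrite 1 [← hI2]
      rw [← hJ2, Submodule.span_mul_span]
      refine Submodule.span_mono ?_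
      rintro _ ⟨x, hx, y, hy, rfl⟩
      exact Submodule.mul_mem_mul hx hy

/-- Linear equivalence of fractional ideals, `I = k J` for some `k ∈ K^×`, as a congruence. -/
def linearEquivalence [Module.Finite ℤ R] : Con (fractionalIdeals R) where
  r I J := ∃ k : (TotalAlgebra R)ˣ,
    (I : Submodule R (TotalAlgebra R)) = Submodule.span R {(k : TotalAlgebra R)} * J
  iseqv :=
    { refl := fun I => ⟨1, by rw [Units.val_one, ← Submodule.one_eq_span, one_mul]⟩
      symm := by
        rintro I J ⟨k, hk⟩
        refine ⟨k⁻¹, ?_⟩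
        rw [hk, ← mul_assoc, Submodule.span_mul_span, Set.singleton_mul_singleton,
          Units.inv_mul, ← Submodule.one_eq_span, one_mul]
      trans := by
        rintro I J L ⟨k, hk⟩ ⟨l, hl⟩
        refine ⟨k * l, ?_⟩
        rw [hk, hl, ← mul_assoc, Submodule.span_mul_span, Set.singleton_mul_singleton,
          Units.val_mul] }
  mul' := by
    rintro I J L M ⟨k, hk⟩ ⟨l, hl⟩
    refine ⟨k * l, ?_⟩
    rw [Submonoid.coe_mul, Submonoid.coe_mul, hk, hl, mul_mul_mul_comm, Submodule.span_mul_span,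
      Set.singleton_mul_singleton, Units.val_mul]

/-- The ideal class monoid: fractional ideals modulo linear equivalence. -/
abbrev IdealClassMonoid [Module.Finite ℤ R] : Type := (linearEquivalence R).Quotient

/-- The ideal class group: the group of units of the ideal class monoid. -/
abbrev IdealClassGroup [Module.Finite ℤ R] : Type := (IdealClassMonoid R)ˣ

end General

/-! ### The orders `ℤ[x] / ((x - a_1) ⋯ (x - a_n))` -/

section Degenerate

variable {n : ℕ} (a : Fin n → ℤ)

/-- `χ(x) = (x - a_1) ⋯ (x - a_n)`. -/
def chi : ℤ[X] := ∏ i, (X - C (a i))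

theorem chi_monic : (chi a).Monic := monic_prod_X_sub_C a Finset.univ

/-- `R = ℤ[x] / (χ(x))`. -/
abbrev RootOrder : Type := AdjoinRoot (chi a)

instance finite_rootOrder : Module.Finite ℤ (RootOrder a) := (chi_monic a).finite_adjoinRoot

/-- The rank of the fractional ideals of `ℤ[x] / (χ(x))` is the number `n` of roots. -/
theorem finrank_total : Module.finrank ℚ (TotalAlgebra (RootOrder a)) = n := by
  have hd : (chi a).natDegree = n := by
    rw [chi, Polynomial.natDegree_finsetProd_X_sub_C_eq_card, Finset.card_univ, Fintype.card_fin]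
  have : Module.Free ℤ (RootOrder a) := (chi_monic a).free_adjoinRoot
  change Module.finrank ℚ (ℚ ⊗[ℤ] RootOrder a) = n
  rw [Module.finrank_baseChange, (AdjoinRoot.powerBasis' (chi_monic a)).finrank,
    AdjoinRoot.powerBasis'_dim, hd]

/-- `Δ = ∏_{i < j} (a_j - a_i)`. -/
def Delta : ℤ := ∏ i, ∏ j ∈ Finset.Ioi i, (a j - a i)

/-- The quantity `|Cl(R)| · 2^{n-1} / φ(Δ)`; for increasing `a` the integer `Δ` is positive. -/
def normalizedClassNumber : ℝ :=
  (Nat.card (IdealClassGroup (RootOrder a)) : ℝ) * 2 ^ (n - 1) / (Nat.totient (Delta a).toNat : ℝ)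

end Degenerate

/-- The filter "`Δ → ∞`" on the set of all sequences `a_1 < ⋯ < a_n` of integers. -/
def deltaToInfinity (n : ℕ) : Filter {a : Fin n → ℤ // StrictMono a} :=
  comap (fun a => Delta a.1) atTop

end OrderClassGroup

end

/-! Evaluation at the roots embeds `R` in the maximal order `ℤⁿ` of `K`, with a Vandermonde
determinant as index; hence the index is `m = Δ` and `mℤⁿ ⊆ R`. Since `ℤⁿ` is a principal ideal
ring, every invertible ideal can be scaled so that it generates `ℤⁿ` over `ℤⁿ`, and is then `uR +
mℤⁿ` with `u` a unit modulo `m`. With `R̄` the image of `R` in `(ℤ/m)ⁿ`, this makes `(ℤⁿ)ˣ × R̄ˣ →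
((ℤ/m)ⁿ)ˣ → Cl(R) → 1` exact, the first map having kernel in bijection with `Rˣ`. Therefore `Cl(R)`
is finite and `|Cl(R)| · 2ⁿ · |R̄ˣ| = φ(m)ⁿ · |Rˣ|` (`toClassGroup_surjective`, `range_unitsHom`,
`card_idealClassGroup_mul`).

Let `r_p` be the number of residues of the roots modulo `p`. An element of `R̄` is a unit iff its
values at these residues are nonzero for all `p ∣ m`, and by interpolation these values are
arbitrary. As `|R̄| = mⁿ⁻¹`, this gives `|R̄ˣ| = mⁿ⁻¹ ∏ (1 - 1/p)^{r_p}`, and the normalized class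
number becomes `|Rˣ|/2 · ∏_{p ∣ Δ} (1 - 1/p)^{n-1-r_p}` (`normalizedClassNumber_eq`). For large `Δ`
the only units are `±1` (`card_orderUnits`), so only the Euler product matters.

Since `r_p ≤ p`, and every prime `p ≤ n - 2` divides `Δ` by pigeonhole, the product is at most the
claimed limsup; the roots `0, …, n-2` and one large integer attain it. For `n = 2` all exponents
vanish. For `n ≥ 3`, roots in progression with difference `k!` have `r_p = 1` for all `p ≤ k`, and
the product tends to zero because `∑ 1/p` diverges. -/

noncomputable section

namespace OrderClassGroup

/-! ### Invertible submodules and a conductor -/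

section Conductor

variable {R K : Type*} [CommRing R] [CommRing K] [Algebra R K]

/-- If `u` and `v` are units modulo `𝔣`, then `u R + 𝔣` and `v R + 𝔣` multiply to `u v R + 𝔣`. -/
theorem span_sup_mul_span_sup {𝒪 𝔣 : Submodule R K} (h𝔣 : 𝔣 * 𝒪 = 𝔣) {u v : K}
    (hv : v ∈ 𝒪) (hu : Submodule.span R {u} * 𝒪 ⊔ 𝔣 = 𝒪) :
    (Submodule.span R {u} ⊔ 𝔣) * (Submodule.span R {v} ⊔ 𝔣) =
      Submodule.span R {u * v} ⊔ 𝔣 := by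
  -- `𝔣` is stable under `𝒪`, so the cross term `u𝔣` may be read as `u𝒪𝔣`; together with `𝔣²` it
  -- fills `𝔣`, as `u` is a unit modulo `𝔣`.
  have h1 : Submodule.span R {u} * 𝔣 ⊔ 𝔣 * 𝔣 = 𝔣 := by
    calc Submodule.span R {u} * 𝔣 ⊔ 𝔣 * 𝔣
        = Submodule.span R {u} * (𝔣 * 𝒪) ⊔ 𝔣 * 𝔣 := by rw [h𝔣]
      _ = 𝔣 * (Submodule.span R {u} * 𝒪 ⊔ 𝔣) := by
          rw [Submodule.mul_sup]; congr 1; ring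
      _ = 𝔣 := by rw [hu, h𝔣]
  have h2 : 𝔣 * Submodule.span R {v} ≤ 𝔣 := by
    conv_rhs => rw [← h𝔣]
    exact mul_le_mul' le_rfl (by simpa using hv)
  rw [Submodule.mul_sup, Submodule.sup_mul, Submodule.sup_mul, Submodule.span_mul_span,
    Set.singleton_mul_singleton, sup_assoc, h1]
  congr 1
  exact sup_eq_right.2 h2

/-- An invertible submodule is generated, modulo a conductor contained in finitely many maximal
ideals only, by a single element. -/
theorem exists_eq_span_sup {𝒪 𝔣 I N : Submodule R K} (h𝔣 : 𝔣 * 𝒪 = 𝔣) (h𝔣1 : 𝔣 ≤ 1)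
    (hfin : {P : Ideal R | P.IsMaximal ∧ 𝔣.comap (Algebra.linearMap R K) ≤ P}.Finite)
    (hIN : I * N = 1) (hI : I * 𝒪 = 𝒪) :
    ∃ u ∈ I, I = Submodule.span R {u} ⊔ 𝔣 := by
  classical
  have h𝔣I : 𝔣 * I = 𝔣 := by
    calc 𝔣 * I = 𝔣 * 𝒪 * I := by rw [h𝔣]
      _ = 𝔣 * (I * 𝒪) := by ring
      _ = 𝔣 := by rw [hI, h𝔣]
  let S := {P : Ideal R | P.IsMaximal ∧ 𝔣.comap (Algebra.linearMap R K) ≤ P}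
  have : Fintype S := hfin.fintype
  -- `algebraMap R K` is not assumed injective, but its kernel lies in the preimage of `𝔣`, hence in
  -- every `P` of `S`.
  have hker : ∀ P : S, ∀ r, algebraMap R K r = 0 → r ∈ P.1 := fun P r hr =>
    P.2.2 (by simp [hr])
  -- Otherwise all products `x * y` would lie in the image of `P`, contradicting `1 ∈ I * N`.
  have key : ∀ P : S, ∃ x ∈ I, ∃ y ∈ N, ∃ r, r ∉ P.1 ∧ algebraMap R K r = x * y := by
    intro P
    by_contra! hcon
    have hle : I * N ≤ Submodule.map (Algebra.linearMap R K) P.1 := by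
      rw [Submodule.mul_le]
      intro x hx y hy
      have : x * y ∈ I * N := Submodule.mul_mem_mul hx hy
      rw [hIN, Submodule.mem_one] at this
      obtain ⟨r, hr⟩ := this
      exact ⟨r, by_contra fun h => hcon x hx y hy r h hr, hr⟩
    rw [hIN, Submodule.one_le] at hle
    obtain ⟨r, hr, hr1⟩ := hle
    refine P.2.1.ne_top ((Ideal.eq_top_iff_one _).2 ?_)
    have := P.1.add_mem hr (hker P (1 - r) (by
      rw [map_sub, map_one, ← hr1, Algebra.linearMap_apply, sub_self]))
    simpa using this
  choose x hx y hy r hr hrxy using key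
  have hcop : Pairwise (Function.onFun IsCoprime fun P : S => P.1) := fun P Q hPQ =>
    Ideal.isCoprime_iff_sup_eq.2
      (Ideal.IsMaximal.coprime_of_ne P.2.1 Q.2.1 fun h => hPQ (Subtype.ext h))
  -- By the Chinese remainder theorem `e P` is `1` modulo `P` and `0` modulo the other ideals of
  -- `S`. Thus `u * y P ≡ x P * y P` modulo `P`, which is nonzero there.
  choose e he using fun P : S =>
    Ideal.exists_forall_sub_mem_ideal hcop (fun Q => if Q = P then (1 : R) else 0)
  set u : K := ∑ P, e P • x P with hu
  have huI : u ∈ I := Submodule.sum_mem _ fun P _ => I.smul_mem _ (hx P)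
  have hprod : ∀ P Q : S, ∃ t : R, algebraMap R K t = x P * y Q := by
    intro P Q
    have : x P * y Q ∈ I * N := Submodule.mul_mem_mul (hx P) (hy Q)
    rwa [hIN, Submodule.mem_one] at this
  choose t ht using hprod
  -- A maximal ideal over this one contains the preimage of `𝔣`, so it belongs to `S`, where the
  -- choice of `u` excludes it.
  have htop : (Submodule.span R {u} * N ⊔ 𝔣).comap (Algebra.linearMap R K) = ⊤ := by
    by_contra hne
    obtain ⟨P, hP, hle⟩ := Ideal.exists_le_maximal _ hne
    have hPS : P ∈ S := ⟨hP, (Submodule.comap_mono le_sup_right).trans hle⟩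
    let P' : S := ⟨P, hPS⟩
    have h1 : ∑ Q, e Q * t Q P' ∈ P := by
      refine hle ?_
      rw [Submodule.mem_comap]
      refine Submodule.mem_sup_left ?_
      have : Algebra.linearMap R K (∑ Q, e Q * t Q P') = u * y P' := by
        rw [Algebra.linearMap_apply, map_sum, hu, Finset.sum_mul]
        refine Finset.sum_congr rfl fun Q _ => ?_
        rw [map_mul, ht, Algebra.smul_def, mul_assoc]
      rw [this]
      exact Submodule.mul_mem_mul (Submodule.mem_span_singleton_self _) (hy P')
    have h2 : ∑ Q, e Q * t Q P' - t P' P' ∈ P := by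
      have : ∑ Q, e Q * t Q P' - t P' P' =
          ∑ Q, (e Q - if P' = Q then (1 : R) else 0) * t Q P' := by
        simp [sub_mul, Finset.sum_sub_distrib]
      rw [this]
      exact Ideal.sum_mem _ fun Q _ => P.mul_mem_right _ (he Q P')
    have h3 : t P' P' ∈ P := by simpa using P.sub_mem h1 h2
    have h4 : r P' - t P' P' ∈ P := hker P' _ (by rw [map_sub, ht, hrxy, sub_self])
    exact hr P' (by simpa using P.add_mem h3 h4)
  have hone : Submodule.span R {u} * N ⊔ 𝔣 = 1 := by
    refine le_antisymm (sup_le ?_ h𝔣1) ?_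
    · rw [← hIN]
      exact mul_le_mul' (by simpa using huI) le_rfl
    · have h1 : (1 : R) ∈ (Submodule.span R {u} * N ⊔ 𝔣).comap (Algebra.linearMap R K) := by
        rw [htop]; trivial
      rw [Submodule.one_le]
      simpa using h1
  refine ⟨u, huI, ?_⟩
  calc I = (Submodule.span R {u} * N ⊔ 𝔣) * I := by rw [hone, one_mul]
    _ = Submodule.span R {u} * (I * N) ⊔ 𝔣 * I := by rw [Submodule.sup_mul]; congr 1; ring
    _ = Submodule.span R {u} ⊔ 𝔣 := by rw [hIN, mul_one, h𝔣I]

end Conductor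

/-! ### The class group of an order in `ℤⁿ` -/

/-- An order `R` of conductor dividing `m` in the maximal order `ℤⁿ` of `ℚ ⊗ R`. -/
structure SplitOrder (R : Type) [CommRing R] (n m : ℕ) where
  /-- the embedding of `R` into the maximal order -/
  ev : R →+* (Fin n → ℤ)
  /-- the embedding of the maximal order into the total algebra -/
  emb : (Fin n → ℤ) →+* TotalAlgebra R
  emb_injective : Function.Injective emb
  algebraMap_eq : ∀ r, algebraMap R (TotalAlgebra R) r = emb (ev r)
  conductor : ∀ z, ∃ r, ev r = (m : Fin n → ℤ) * z
  exists_denominator : ∀ k, ∃ d : ℕ, d ≠ 0 ∧ ∃ z, (d : TotalAlgebra R) * k = emb z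

/-- Coordinatewise reduction modulo `m`. -/
def reduction (n m : ℕ) : (Fin n → ℤ) →+* (Fin n → ZMod m) :=
  RingHom.pi fun i => (Int.castRingHom (ZMod m)).comp (Pi.evalRingHom _ i)

@[simp]
theorem reduction_apply {n m : ℕ} (z : Fin n → ℤ) (i : Fin n) : reduction n m z i = (z i : ZMod m) :=
  rfl

theorem reduction_surjective (n m : ℕ) : Function.Surjective (reduction n m) := fun a =>
  ⟨fun i => (ZMod.intCast_surjective (a i)).choose,
    funext fun i => (ZMod.intCast_surjective (a i)).choose_spec⟩

theorem reduction_eq_zero_iff {n m : ℕ} {z : Fin n → ℤ} :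
    reduction n m z = 0 ↔ ∃ w, z = (m : Fin n → ℤ) * w := by
  constructor
  · intro h
    have h1 : ∀ i, (m : ℤ) ∣ z i := fun i =>
      (ZMod.intCast_zmod_eq_zero_iff_dvd _ _).1 (by simpa using congrFun h i)
    choose w hw using h1
    exact ⟨w, funext fun i => by simp [hw i]⟩
  · rintro ⟨w, rfl⟩
    funext i
    simp

namespace SplitOrder

variable {R : Type} [CommRing R] {n m : ℕ} (D : SplitOrder R n m)

theorem smul_emb (r : R) (z : Fin n → ℤ) : r • D.emb z = D.emb (D.ev r * z) := by
  rw [Algebra.smul_def, D.algebraMap_eq, map_mul]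

/-- The maximal order as a submodule of the total algebra. -/
def maxOrder : Submodule R (TotalAlgebra R) where
  carrier := Set.range D.emb
  zero_mem' := ⟨0, map_zero _⟩
  add_mem' := by rintro _ _ ⟨z, rfl⟩ ⟨w, rfl⟩; exact ⟨z + w, map_add _ _ _⟩
  smul_mem' := by rintro r _ ⟨z, rfl⟩; exact ⟨_, (D.smul_emb r z).symm⟩

theorem emb_mem (z : Fin n → ℤ) : D.emb z ∈ D.maxOrder := ⟨z, rfl⟩

theorem one_le_maxOrder : 1 ≤ D.maxOrder := Submodule.one_le.2 ⟨1, map_one _⟩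

theorem maxOrder_mul_self : D.maxOrder * D.maxOrder = D.maxOrder := by
  refine le_antisymm (Submodule.mul_le.2 ?_) ?_
  · rintro _ ⟨z, rfl⟩ _ ⟨w, rfl⟩
    exact ⟨z * w, map_mul _ _ _⟩
  · calc D.maxOrder = D.maxOrder * 1 := (mul_one _).symm
      _ ≤ _ := mul_le_mul' le_rfl D.one_le_maxOrder

/-- The lattice `m ℤⁿ` in the total algebra. -/
def cond : Submodule R (TotalAlgebra R) :=
  Submodule.span R {D.emb m} * D.maxOrder

theorem mem_cond {x : TotalAlgebra R} : x ∈ D.cond ↔ ∃ z, D.emb (m * z) = x := by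
  rw [cond, Submodule.mem_span_singleton_mul]
  constructor
  · rintro ⟨_, ⟨z, rfl⟩, rfl⟩
    exact ⟨z, map_mul _ _ _⟩
  · rintro ⟨z, rfl⟩
    exact ⟨_, D.emb_mem z, (map_mul _ _ _).symm⟩

theorem emb_mem_cond {z : Fin n → ℤ} : D.emb z ∈ D.cond ↔ reduction n m z = 0 := by
  rw [D.mem_cond, reduction_eq_zero_iff]
  exact ⟨fun ⟨w, hw⟩ => ⟨w, (D.emb_injective hw).symm⟩, fun ⟨w, hw⟩ => ⟨w, by rw [hw]⟩⟩

theorem cond_mul_maxOrder : D.cond * D.maxOrder = D.cond := by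
  rw [cond, mul_assoc, D.maxOrder_mul_self]

theorem cond_le_one : D.cond ≤ 1 := by
  intro x hx
  obtain ⟨z, rfl⟩ := D.mem_cond.1 hx
  obtain ⟨r, hr⟩ := D.conductor z
  exact Submodule.mem_one.2 ⟨r, by rw [D.algebraMap_eq, hr]⟩

theorem cond_le_maxOrder : D.cond ≤ D.maxOrder := D.cond_le_one.trans D.one_le_maxOrder

/-- The quotient of the maximal order by `cond` is `(ℤ/m)ⁿ`. This translates the hypothesis of
`span_sup_mul_span_sup` into invertibility of residues. -/
theorem span_mul_maxOrder_sup_cond {u : Fin n → ℤ} :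
    Submodule.span R {D.emb u} * D.maxOrder ⊔ D.cond = D.maxOrder ↔
      IsUnit (reduction n m u) := by
  constructor
  · intro h
    have h1 : D.emb 1 ∈ Submodule.span R {D.emb u} * D.maxOrder ⊔ D.cond := by
      rw [h]; exact D.emb_mem 1
    obtain ⟨x, hx, y, hy, hxy⟩ := Submodule.mem_sup.1 h1
    obtain ⟨_, ⟨w, rfl⟩, rfl⟩ := Submodule.mem_span_singleton_mul.1 hx
    obtain ⟨z, rfl⟩ := D.mem_cond.1 hy
    rw [← map_mul, ← map_add] at hxy
    have h2 := congrArg (reduction n m) (D.emb_injective hxy)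
    rw [map_add, reduction_eq_zero_iff.2 ⟨z, rfl⟩, add_zero, map_mul, map_one] at h2
    exact IsUnit.of_mul_eq_one _ h2
  · rintro ⟨a, ha⟩
    obtain ⟨w, hw⟩ := reduction_surjective n m ↑a⁻¹
    refine le_antisymm (sup_le ?_ D.cond_le_maxOrder) ?_
    · conv_rhs => rw [← D.maxOrder_mul_self]
      exact mul_le_mul' (by simpa using D.emb_mem u) le_rfl
    · rintro _ ⟨z, rfl⟩
      have h1 : D.emb (z - u * (w * z)) ∈ D.cond := by
        rw [D.emb_mem_cond, map_sub, map_mul, map_mul, hw, ← ha, Units.mul_inv_cancel_left, sub_self]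
      have h2 : D.emb (u * (w * z)) ∈ Submodule.span R {D.emb u} * D.maxOrder := by
        rw [map_mul]
        exact Submodule.mul_mem_mul (Submodule.mem_span_singleton_self _) (D.emb_mem _)
      have := Submodule.add_mem_sup h2 h1
      rwa [← map_add, add_sub_cancel] at this

/-- The preimage in `ℤⁿ` of the submodule of `(ℤ/m)ⁿ` generated by `a`. -/
def residueIdeal (a : Fin n → ZMod m) : Submodule R (TotalAlgebra R) where
  carrier := {x | ∃ z r, D.emb z = x ∧ reduction n m z = a * reduction n m (D.ev r)}
  zero_mem' := ⟨0, 0, map_zero _, by simp⟩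
  add_mem' := by
    rintro _ _ ⟨z, r, rfl, hz⟩ ⟨w, s, rfl, hw⟩
    exact ⟨z + w, r + s, map_add _ _ _, by simp only [map_add, hz, hw, mul_add]⟩
  smul_mem' := by
    rintro t _ ⟨z, r, rfl, hz⟩
    exact ⟨_, t * r, (D.smul_emb t z).symm, by simp only [map_mul, hz]; ring⟩

theorem emb_mem_residueIdeal {a : Fin n → ZMod m} {z : Fin n → ℤ} :
    D.emb z ∈ D.residueIdeal a ↔ ∃ r, reduction n m z = a * reduction n m (D.ev r) :=
  ⟨fun ⟨_, r, h1, h2⟩ => ⟨r, by rw [← h2, D.emb_injective h1]⟩, fun ⟨r, hr⟩ => ⟨z, r, rfl, hr⟩⟩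

theorem residueIdeal_le_maxOrder (a : Fin n → ZMod m) : D.residueIdeal a ≤ D.maxOrder := by
  rintro _ ⟨z, _, rfl, _⟩
  exact D.emb_mem z

theorem cond_le_residueIdeal (a : Fin n → ZMod m) : D.cond ≤ D.residueIdeal a := by
  intro x hx
  obtain ⟨z, rfl⟩ := D.mem_cond.1 hx
  exact D.emb_mem_residueIdeal.2 ⟨0, by
    rw [reduction_eq_zero_iff.2 ⟨z, rfl⟩]; simp⟩

/-- `residueIdeal` depends only on a residue, as a homomorphism from units modulo `m` requires; a
lift `u` puts it in the form treated by the conductor lemmas. -/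
theorem residueIdeal_reduction (u : Fin n → ℤ) :
    D.residueIdeal (reduction n m u) = Submodule.span R {D.emb u} ⊔ D.cond := by
  refine le_antisymm ?_ (sup_le ?_ (D.cond_le_residueIdeal _))
  · rintro _ ⟨z, r, rfl, h⟩
    have h1 : D.emb (z - D.ev r * u) ∈ D.cond := by
      rw [D.emb_mem_cond, map_sub, h, map_mul, mul_comm, sub_self]
    have := Submodule.add_mem_sup
      (Submodule.smul_mem _ r (Submodule.mem_span_singleton_self (D.emb u))) h1
    rwa [D.smul_emb, ← map_add, add_sub_cancel] at this
  · simpa using D.emb_mem_residueIdeal.2 ⟨1, by simp⟩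

theorem residueIdeal_mul (a b : (Fin n → ZMod m)ˣ) :
    D.residueIdeal a * D.residueIdeal b = D.residueIdeal (a * b : (Fin n → ZMod m)ˣ) := by
  obtain ⟨u, hu⟩ := reduction_surjective n m a
  obtain ⟨v, hv⟩ := reduction_surjective n m b
  rw [Units.val_mul, ← hu, ← hv, ← map_mul, D.residueIdeal_reduction, D.residueIdeal_reduction,
    D.residueIdeal_reduction, map_mul]
  exact span_sup_mul_span_sup D.cond_mul_maxOrder (D.emb_mem v)
    (D.span_mul_maxOrder_sup_cond.2 (hu ▸ a.isUnit))

theorem residueIdeal_one : D.residueIdeal 1 = 1 := by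
  rw [← map_one (reduction n m), D.residueIdeal_reduction, map_one, ← Submodule.one_eq_span]
  exact sup_eq_left.2 D.cond_le_one

theorem isFractionalIdeal_of_le [Module.Finite ℤ R] (hm : m ≠ 0)
    {I : Submodule R (TotalAlgebra R)} (h1 : D.cond ≤ I) (h2 : I ≤ D.maxOrder) :
    IsFractionalIdeal I := by
  refine (isFractionalIdeal_iff _).2 ⟨?_, ?_⟩
  · have : I.restrictScalars ℤ =
        ((I.restrictScalars ℤ).comap D.emb.toAddMonoidHom.toIntLinearMap).map
          D.emb.toAddMonoidHom.toIntLinearMap := by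
      rw [Submodule.map_comap_eq, right_eq_inf]
      intro x hx
      exact h2 hx
    rw [this]
    exact (IsNoetherian.noetherian _).map _
  · rw [eq_top_iff]
    intro k _
    obtain ⟨d, hd, z, hz⟩ := D.exists_denominator k
    have h3 : ((d * m : ℕ) : ℚ) • k ∈ I := by
      refine h1 (D.mem_cond.2 ⟨z, ?_⟩)
      rw [map_mul, ← hz, map_natCast, Nat.cast_smul_eq_nsmul, nsmul_eq_mul]
      push_cast
      ring
    have h4 : ((d * m : ℕ) : ℚ) ≠ 0 := by exact_mod_cast mul_ne_zero hd hm
    rw [← inv_smul_smul₀ h4 k]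
    exact Submodule.smul_mem _ _ (Submodule.subset_span h3)

end SplitOrder

theorem span_units_inv_mul {R K : Type*} [CommRing R] [CommRing K] [Algebra R K] (x : Kˣ) :
    Submodule.span R {((x⁻¹ : Kˣ) : K)} * Submodule.span R {(x : K)} = 1 := by
  rw [Submodule.span_mul_span, Set.singleton_mul_singleton, Units.inv_mul, Submodule.one_eq_span]

/-! ### Exact sequence relating units and ideal classes -/

namespace SplitOrder

variable {R : Type} [CommRing R] {n m : ℕ} (D : SplitOrder R n m)

theorem isUnit_natCast {d : ℕ} (hd : d ≠ 0) : IsUnit (d : TotalAlgebra R) := by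
  have h : IsUnit (d : ℚ) := isUnit_iff_ne_zero.2 (by exact_mod_cast hd)
  simpa using h.map (algebraMap ℚ (TotalAlgebra R))

theorem exists_common_denominator {I : Submodule ℤ (TotalAlgebra R)} (hI : I.FG) :
    ∃ d : ℕ, d ≠ 0 ∧ ∀ x ∈ I, (d : TotalAlgebra R) * x ∈ D.maxOrder := by
  induction I, hI using Submodule.fg_induction with
  | singleton x =>
    obtain ⟨d, hd, z, hz⟩ := D.exists_denominator x
    refine ⟨d, hd, fun y hy => ?_⟩
    obtain ⟨c, rfl⟩ := Submodule.mem_span_singleton.1 hy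
    rw [mul_smul_comm, hz, ← map_zsmul]
    exact D.emb_mem _
  | sup I J _ _ hI hJ =>
    obtain ⟨d, hd, h1⟩ := hI
    obtain ⟨e, he, h2⟩ := hJ
    refine ⟨d * e, mul_ne_zero hd he, fun x hx => ?_⟩
    obtain ⟨y, hy, z, hz, rfl⟩ := Submodule.mem_sup.1 hx
    have h3 := D.maxOrder.smul_mem (e : R) (h1 y hy)
    have h4 := D.maxOrder.smul_mem (d : R) (h2 z hz)
    have := add_mem h3 h4
    rw [Algebra.smul_def, Algebra.smul_def, map_natCast, map_natCast] at this
    convert this using 1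
    push_cast
    ring

/-- The extension of an invertible ideal to the maximal order is principal. -/
theorem exists_mul_maxOrder_eq {I N : Submodule R (TotalAlgebra R)}
    (hI : (I.restrictScalars ℤ).FG) (hIN : I * N = 1) :
    ∃ x : (TotalAlgebra R)ˣ,
      I * D.maxOrder = Submodule.span R {(x : TotalAlgebra R)} * D.maxOrder := by
  obtain ⟨d, hd, hdI⟩ := D.exists_common_denominator hI
  obtain ⟨δ, hδ⟩ := isUnit_natCast (R := R) hd
  let L : Submodule R (TotalAlgebra R) :=
    Submodule.span R {(δ : TotalAlgebra R)} * (I * D.maxOrder)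
  have hL : L * D.maxOrder = L := by
    rw [mul_assoc, mul_assoc, D.maxOrder_mul_self]
  have hLle : L ≤ D.maxOrder := by
    change Submodule.span R {(δ : TotalAlgebra R)} * (I * D.maxOrder) ≤ _
    rw [← mul_assoc]
    conv_rhs => rw [← D.maxOrder_mul_self]
    refine mul_le_mul' ?_ le_rfl
    intro y hy
    obtain ⟨x, hx, rfl⟩ := Submodule.mem_span_singleton_mul.1 hy
    rw [hδ]
    exact hdI x hx
  -- With denominators cleared, the extended ideal is an ideal of `ℤⁿ`, hence principal.
  let 𝔞 : Ideal (Fin n → ℤ) :=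
    { carrier := {z | D.emb z ∈ L}
      zero_mem' := by simp
      add_mem' := fun {z w} hz hw => by
        have := L.add_mem hz hw
        rwa [← map_add] at this
      smul_mem' := fun w z hz => by
        have := Submodule.mul_mem_mul (show D.emb z ∈ L from hz) (D.emb_mem w)
        rwa [hL, ← map_mul, mul_comm] at this }
  obtain ⟨g, hg⟩ := IsPrincipalIdealRing.principal 𝔞
  have hLg : L = Submodule.span R {D.emb g} * D.maxOrder := by
    apply le_antisymm
    · intro x hx
      obtain ⟨z, rfl⟩ := hLle hx
      have hz : z ∈ 𝔞 := hx
      rw [hg] at hz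
      obtain ⟨w, rfl⟩ := Ideal.mem_span_singleton'.1 hz
      rw [mul_comm w g, map_mul]
      exact Submodule.mul_mem_mul (Submodule.mem_span_singleton_self _) (D.emb_mem w)
    · rw [← hL]
      refine mul_le_mul' ?_ le_rfl
      have : g ∈ 𝔞 := by rw [hg]; exact Submodule.mem_span_singleton_self g
      exact (Submodule.span_singleton_le_iff_mem _ _).2 this
  have hI' : I * D.maxOrder =
      Submodule.span R {((δ⁻¹ : (TotalAlgebra R)ˣ) : TotalAlgebra R) * D.emb g} * D.maxOrder := by
    calc I * D.maxOrder = Submodule.span R {((δ⁻¹ : (TotalAlgebra R)ˣ) : TotalAlgebra R)} * L := by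
          rw [← mul_assoc, span_units_inv_mul, one_mul]
      _ = _ := by
          rw [hLg, ← mul_assoc, Submodule.span_mul_span, Set.singleton_mul_singleton]
  -- Multiplying the principal extension by `N` gives the maximal order, which contains `1`; so the
  -- generator divides `1`.
  have hunit : IsUnit (((δ⁻¹ : (TotalAlgebra R)ˣ) : TotalAlgebra R) * D.emb g) := by
    have h1 : (1 : TotalAlgebra R) ∈
        Submodule.span R {((δ⁻¹ : (TotalAlgebra R)ˣ) : TotalAlgebra R) * D.emb g} *
          (D.maxOrder * N) := by
      rw [← mul_assoc, ← hI', mul_right_comm, hIN, one_mul]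
      exact Submodule.one_le.1 D.one_le_maxOrder
    obtain ⟨y, _, hy⟩ := Submodule.mem_span_singleton_mul.1 h1
    exact IsUnit.of_mul_eq_one _ hy
  exact ⟨hunit.unit, hI'⟩

/-- An ideal containing the conductor is determined by its image in the finite ring `(ℤ/m)ⁿ`. -/
theorem finite_maximal_cond_le [NeZero m] :
    {P : Ideal R | P.IsMaximal ∧
      D.cond.comap (Algebra.linearMap R (TotalAlgebra R)) ≤ P}.Finite := by
  let f : R → (Fin n → ZMod m) := fun r => reduction n m (D.ev r)
  have hf : ∀ {P : Ideal R}, D.cond.comap (Algebra.linearMap R (TotalAlgebra R)) ≤ P →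
      ∀ r, f r ∈ f '' P → r ∈ P := by
    rintro P hP r ⟨s, hs, hsr⟩
    have : r - s ∈ P := by
      refine hP ?_
      rw [Submodule.mem_comap, Algebra.linearMap_apply, D.algebraMap_eq, D.emb_mem_cond, map_sub,
        map_sub]
      exact sub_eq_zero.2 hsr.symm
    simpa using P.add_mem this hs
  refine Set.Finite.of_injOn (f := fun P : Ideal R => f '' (P : Set R)) (t := Set.univ)
    (fun _ _ => trivial) ?_ Set.finite_univ
  rintro P ⟨_, hP⟩ Q ⟨_, hQ⟩ (h : f '' _ = f '' _)
  ext r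
  exact ⟨fun hr => hf hQ r (h ▸ ⟨r, hr, rfl⟩), fun hr => hf hP r (h ▸ ⟨r, hr, rfl⟩)⟩

/-- Since `mℤⁿ` lies in `R`, membership in `R` is decided modulo `m`. -/
theorem exists_ev_eq_iff {z : Fin n → ℤ} :
    (∃ r, D.ev r = z) ↔ ∃ r, reduction n m (D.ev r) = reduction n m z := by
  refine ⟨fun ⟨r, hr⟩ => ⟨r, by rw [hr]⟩, fun ⟨r, hr⟩ => ?_⟩
  obtain ⟨w, hw⟩ := reduction_eq_zero_iff.1 (show reduction n m (z - D.ev r) = 0 by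
    rw [map_sub, hr, sub_self])
  obtain ⟨s, hs⟩ := D.conductor w
  exact ⟨r + s, by rw [map_add, hs, ← hw, add_sub_cancel]⟩

/-- The units of `ℤⁿ` that lie in `R`. -/
def orderUnits : Subgroup (Fin n → ℤ)ˣ where
  carrier := {w | ∃ r, D.ev r = w}
  one_mem' := ⟨1, by simp⟩
  mul_mem' := by
    rintro a b ⟨r, hr⟩ ⟨s, hs⟩
    exact ⟨r * s, by rw [map_mul, hr, hs, Units.val_mul]⟩
  inv_mem' := by
    rintro a ⟨r, hr⟩
    -- The coordinates of a unit of `ℤⁿ` are `±1`, so it is its own inverse and the same `r` serves.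
    refine ⟨r, ?_⟩
    rw [hr]
    funext i
    have h : IsUnit ((a : Fin n → ℤ) i) := a.isUnit.map (Pi.evalRingHom _ i)
    have h1 : (a : Fin n → ℤ) i * ((a⁻¹ : (Fin n → ℤ)ˣ) : Fin n → ℤ) i = 1 :=
      congrFun a.mul_inv i
    rcases Int.isUnit_iff.1 h with h | h <;> rw [h] at h1 ⊢ <;> linarith

variable [NeZero m]

/-- The units modulo `m` that come from `R`. -/
def residueUnits : Subgroup (Fin n → ZMod m)ˣ where
  carrier := {a | ∃ r, reduction n m (D.ev r) = a}
  one_mem' := ⟨1, by simp⟩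
  mul_mem' := by
    rintro a b ⟨r, hr⟩ ⟨s, hs⟩
    exact ⟨r * s, by rw [map_mul, map_mul, hr, hs, Units.val_mul]⟩
  inv_mem' := by
    rintro a ⟨r, hr⟩
    -- The lift `r` need not be invertible in `R`; in a finite group, however, the inverse is a
    -- power.
    refine ⟨r ^ (Nat.card (Fin n → ZMod m)ˣ - 1), ?_⟩
    rw [map_pow, map_pow, hr, ← Units.val_pow_eq_pow_val]
    congr 1
    rw [eq_inv_iff_mul_eq_one, ← pow_succ, Nat.sub_add_cancel Nat.card_pos, pow_card_eq_one']

/-- Multiplication of global units and of residue units of the order. -/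
def unitsHom : (Fin n → ℤ)ˣ × D.residueUnits →* (Fin n → ZMod m)ˣ :=
  (Units.map (reduction n m : (Fin n → ℤ) →* (Fin n → ZMod m))).coprod D.residueUnits.subtype

/-- In a kernel pair the second entry is the inverse of `w` modulo `m`, so `w` determines the pair;
it occurs exactly when `w` modulo `m` comes from `R`, that is, when `w` lies in `R`. -/
theorem card_ker_unitsHom : Nat.card D.unitsHom.ker = Nat.card D.orderUnits := by
  refine Nat.card_congr (Equiv.ofBijective (fun p => (⟨p.1.1, ?_⟩ : D.orderUnits)) ⟨?_, ?_⟩)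
  · obtain ⟨⟨w, b⟩, h⟩ := p
    obtain ⟨r, hr⟩ := (b⁻¹ : D.residueUnits).2
    refine D.exists_ev_eq_iff.2 ⟨r, ?_⟩
    rw [hr]
    have h1 : Units.map (reduction n m : (Fin n → ℤ) →* (Fin n → ZMod m)) w * b = 1 := h
    exact congrArg Units.val (eq_inv_of_mul_eq_one_left h1).symm
  · rintro ⟨⟨w, b⟩, h⟩ ⟨⟨w', b'⟩, h'⟩ hww
    have hw : w = w' := congrArg Subtype.val hww
    subst hw
    rw [MonoidHom.mem_ker] at h h'
    have := h.trans h'.symm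
    have hb : b = b' := Subtype.ext (mul_left_cancel this)
    subst hb
    rfl
  · rintro ⟨w, r, hr⟩
    let W := Units.map (reduction n m : (Fin n → ℤ) →* (Fin n → ZMod m)) w
    have hW : W ∈ D.residueUnits := ⟨r, by rw [hr]; rfl⟩
    refine ⟨⟨(w, (⟨W, hW⟩ : D.residueUnits)⁻¹), ?_⟩, rfl⟩
    rw [MonoidHom.mem_ker]
    exact mul_inv_cancel W

variable [Module.Finite ℤ R]

/-- The homomorphism from units modulo `m` to ideal classes. -/
def toClassGroup : (Fin n → ZMod m)ˣ →* IdealClassGroup R :=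
  MonoidHom.toHomUnits ((linearEquivalence R).mk'.comp
    { toFun := fun a => (⟨D.residueIdeal a, D.isFractionalIdeal_of_le (NeZero.ne m)
        (D.cond_le_residueIdeal a) (D.residueIdeal_le_maxOrder a)⟩ : fractionalIdeals R)
      map_one' := Subtype.ext D.residueIdeal_one
      map_mul' := fun a b => Subtype.ext (D.residueIdeal_mul a b).symm })

theorem toClassGroup_eq_iff {a : (Fin n → ZMod m)ˣ} {c : IdealClassGroup R}
    {I : fractionalIdeals R} (hI : (linearEquivalence R).mk' I = c) :
    D.toClassGroup a = c ↔ ∃ k : (TotalAlgebra R)ˣ,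
      D.residueIdeal a = Submodule.span R {(k : TotalAlgebra R)} * I := by
  rw [Units.ext_iff, ← hI]
  exact (linearEquivalence R).eq

/-- Dividing by a generator of the extension to the maximal order leaves an ideal `I1` whose
extension is trivial; `exists_eq_span_sup` then yields a single generator modulo the conductor. -/
theorem toClassGroup_surjective : Function.Surjective D.toClassGroup := by
  intro c
  obtain ⟨I, hI⟩ := (linearEquivalence R).mk'_surjective (c : IdealClassMonoid R)
  obtain ⟨I', hI'⟩ := (linearEquivalence R).mk'_surjective
    ((c⁻¹ : IdealClassGroup R) : IdealClassMonoid R)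
  have h1 : (linearEquivalence R).mk' (I * I') = (linearEquivalence R).mk' 1 := by
    rw [map_mul, hI, hI', map_one, Units.mul_inv]
  obtain ⟨k, hk⟩ := (linearEquivalence R).eq.1 h1
  rw [Submonoid.coe_mul, Submonoid.coe_one, mul_one] at hk
  -- In the class monoid `I * I'` is only equivalent to `1`; the factor `k⁻¹` makes the inverse
  -- exact.
  set N : Submodule R (TotalAlgebra R) :=
    Submodule.span R {((k⁻¹ : (TotalAlgebra R)ˣ) : TotalAlgebra R)} * I' with hN
  have hIN : (I : Submodule R (TotalAlgebra R)) * N = 1 := by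
    rw [hN, mul_left_comm, hk, span_units_inv_mul]
  obtain ⟨x, hx⟩ := D.exists_mul_maxOrder_eq I.2.fg hIN
  set I1 : Submodule R (TotalAlgebra R) :=
    Submodule.span R {((x⁻¹ : (TotalAlgebra R)ˣ) : TotalAlgebra R)} * I with hI1
  have h2 : I1 * D.maxOrder = D.maxOrder := by
    rw [hI1, mul_assoc, hx, ← mul_assoc, span_units_inv_mul, one_mul]
  have h3 : I1 * (Submodule.span R {(x : TotalAlgebra R)} * N) = 1 := by
    rw [hI1, mul_mul_mul_comm, span_units_inv_mul, one_mul, hIN]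
  obtain ⟨u, hu, hIu⟩ := exists_eq_span_sup D.cond_mul_maxOrder D.cond_le_one
    D.finite_maximal_cond_le h3 h2
  have h4 : I1 ≤ D.maxOrder := by
    calc I1 = I1 * 1 := (mul_one _).symm
      _ ≤ I1 * D.maxOrder := mul_le_mul' le_rfl D.one_le_maxOrder
      _ = D.maxOrder := h2
  obtain ⟨w, rfl⟩ := h4 hu
  have h5 : IsUnit (reduction n m w) := by
    rw [← D.span_mul_maxOrder_sup_cond]
    conv_lhs => rw [← D.cond_mul_maxOrder]
    rw [← Submodule.sup_mul, ← hIu, h2]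
  refine ⟨h5.unit, (D.toClassGroup_eq_iff hI).2 ⟨x⁻¹, ?_⟩⟩
  rw [IsUnit.unit_spec, D.residueIdeal_reduction, ← hIu]

theorem finite_idealClassGroup (D : SplitOrder R n m) : Finite (IdealClassGroup R) :=
  Finite.of_surjective _ D.toClassGroup_surjective

/-- If the ideal of `a` is `kR`, extension to the maximal order shows that `k` comes from a unit `w`
of `ℤⁿ`; then `w ≡ a r` modulo `m` with `r` in `R`, which factors `a`. Conversely, a global unit `w`
gives the principal ideal `wR`, and a residue unit of `R` gives `R` itself. -/
theorem range_unitsHom : D.unitsHom.range = D.toClassGroup.ker := by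
  have hone : (linearEquivalence R).mk' 1 = ((1 : IdealClassGroup R) : IdealClassMonoid R) :=
    map_one _
  ext a
  rw [MonoidHom.mem_ker, D.toClassGroup_eq_iff hone, Submonoid.coe_one]
  constructor
  · rintro ⟨⟨w, b, r, hr⟩, rfl⟩
    let k : (TotalAlgebra R)ˣ := Units.map (D.emb : (Fin n → ℤ) →* TotalAlgebra R) w
    have hw : D.residueIdeal (reduction n m w) = Submodule.span R {(k : TotalAlgebra R)} := by
      rw [D.residueIdeal_reduction]
      refine sup_eq_left.2 fun x hx => ?_
      obtain ⟨z, rfl⟩ := D.mem_cond.1 hx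
      obtain ⟨s, hs⟩ := D.conductor (((w⁻¹ : (Fin n → ℤ)ˣ) : Fin n → ℤ) * z)
      refine Submodule.mem_span_singleton.2 ⟨s, ?_⟩
      change s • D.emb w = _
      rw [D.smul_emb, hs]
      congr 1
      rw [mul_assoc, mul_right_comm, Units.inv_mul, one_mul]
    have hb : D.residueIdeal b = 1 := by
      -- Applied to both `b` and `b⁻¹`, whose ideals multiply to `1`, this inclusion becomes an
      -- equality.
      have hle : ∀ b : D.residueUnits, D.residueIdeal b.1 ≤ 1 := by
        rintro ⟨b, r, hr⟩
        rw [← hr, D.residueIdeal_reduction, ← D.algebraMap_eq]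
        exact sup_le (by
          rw [Submodule.span_singleton_le_iff_mem]; exact Submodule.algebraMap_mem r) D.cond_le_one
      refine le_antisymm (hle ⟨b, r, hr⟩) ?_
      have h1 := D.residueIdeal_mul b b⁻¹
      rw [mul_inv_cancel, Units.val_one, D.residueIdeal_one] at h1
      calc (1 : Submodule R (TotalAlgebra R))
          = D.residueIdeal b * D.residueIdeal (b⁻¹ : (Fin n → ZMod m)ˣ) := h1.symm
        _ ≤ D.residueIdeal b * 1 :=
          mul_le_mul' le_rfl (hle ((⟨b, r, hr⟩ : D.residueUnits)⁻¹))
        _ = _ := mul_one _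
    refine ⟨k, ?_⟩
    change D.residueIdeal ((Units.map (reduction n m : (Fin n → ℤ) →* _) w * b :
      (Fin n → ZMod m)ˣ) : Fin n → ZMod m) = _
    rw [← D.residueIdeal_mul, hb, ← hw]
    rfl
  · rintro ⟨k, hk⟩
    rw [mul_one] at hk
    obtain ⟨u, hu⟩ := reduction_surjective n m a
    have h1 : Submodule.span R {(k : TotalAlgebra R)} * D.maxOrder = D.maxOrder := by
      rw [← hk, ← hu, D.residueIdeal_reduction, Submodule.sup_mul, D.cond_mul_maxOrder,
        D.span_mul_maxOrder_sup_cond, hu]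
      exact a.isUnit
    obtain ⟨w, hw⟩ : (k : TotalAlgebra R) ∈ D.maxOrder := by
      refine D.residueIdeal_le_maxOrder (a : Fin n → ZMod m) ?_
      rw [hk]
      exact Submodule.mem_span_singleton_self _
    have hwu : IsUnit w := by
      have h2 : (1 : TotalAlgebra R) ∈ Submodule.span R {(k : TotalAlgebra R)} * D.maxOrder := by
        rw [h1]
        exact Submodule.one_le.1 D.one_le_maxOrder
      obtain ⟨_, ⟨z, rfl⟩, hz⟩ := Submodule.mem_span_singleton_mul.1 h2
      rw [← hw, ← map_mul, ← map_one D.emb] at hz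
      exact IsUnit.of_mul_eq_one _ (D.emb_injective hz)
    obtain ⟨w, rfl⟩ := hwu
    have h3 : D.emb w ∈ D.residueIdeal (a : Fin n → ZMod m) := by
      rw [hk, hw]
      exact Submodule.mem_span_singleton_self _
    obtain ⟨r, hr⟩ := D.emb_mem_residueIdeal.1 h3
    let W := Units.map (reduction n m : (Fin n → ℤ) →* (Fin n → ZMod m)) w
    have h4 : a⁻¹ * W ∈ D.residueUnits := by
      refine ⟨r, ?_⟩
      rw [Units.val_mul, eq_comm, Units.inv_mul_eq_iff_eq_mul]
      exact hr
    refine ⟨(w, (⟨a⁻¹ * W, h4⟩ : D.residueUnits)⁻¹), ?_⟩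
    change W * (a⁻¹ * W)⁻¹ = a
    group

theorem card_units_pi_int (n : ℕ) : Nat.card (Fin n → ℤ)ˣ = 2 ^ n := by
  rw [Nat.card_congr MulEquiv.piUnits.toEquiv, Nat.card_pi]
  simp

/-- The class number formula for orders in `ℤⁿ`. -/
theorem card_idealClassGroup_mul :
    Nat.card (IdealClassGroup R) * (2 ^ n * Nat.card D.residueUnits) =
      Nat.card (Fin n → ZMod m)ˣ * Nat.card D.orderUnits := by
  have h1 := D.toClassGroup.ker.card_mul_index
  rw [Subgroup.index_ker, MonoidHom.range_eq_top.2 D.toClassGroup_surjective,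
    Subgroup.card_top, ← D.range_unitsHom] at h1
  have h2 := D.unitsHom.ker.card_mul_index
  rw [Subgroup.index_ker, Nat.card_prod, card_units_pi_int, D.card_ker_unitsHom] at h2
  rw [← h1, ← h2]
  ring

end SplitOrder

/-! ### The orders `ℤ[x] / ((x - a_1) ⋯ (x - a_n))` inside `ℤⁿ` -/

section RootOrder

variable {n : ℕ} (a : Fin n → ℤ)

theorem eval_chi (i : Fin n) : (chi a).eval (a i) = 0 := by
  rw [chi, eval_prod]
  exact Finset.prod_eq_zero (Finset.mem_univ i) (by simp)

/-- Evaluation at the roots. -/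
def rootEval : RootOrder a →+* (Fin n → ℤ) :=
  RingHom.pi fun i => AdjoinRoot.lift (RingHom.id ℤ) (a i) (by
    rw [eval₂_id, eval_chi])

theorem rootEval_mk (f : ℤ[X]) (i : Fin n) :
    rootEval a (AdjoinRoot.mk (chi a) f) i = f.eval (a i) := by
  have h : eval₂ (RingHom.id ℤ) (a i) (chi a) = 0 := by rw [eval₂_id, eval_chi]
  exact (AdjoinRoot.lift_mk h f).trans eval₂_id

theorem natDegree_chi : (chi a).natDegree = n := by
  rw [chi, natDegree_finsetProd_X_sub_C_eq_card, Finset.card_univ, Fintype.card_fin]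

variable {a}

theorem rootEval_injective (ha : Function.Injective a) : Function.Injective (rootEval a) := by
  -- The degree bound on the remainder needs `χ ≠ 1`; for `n = 0` the ring is zero.
  rcases Nat.eq_zero_or_pos n with rfl | hn
  · have h1 : chi a = 1 := by simp [chi]
    have : Subsingleton (RootOrder a) := by
      refine subsingleton_of_zero_eq_one ?_
      rw [← map_one (AdjoinRoot.mk (chi a)), eq_comm, AdjoinRoot.mk_eq_zero, h1]
    exact Function.injective_of_subsingleton _
  rw [injective_iff_map_eq_zero]
  intro r hr
  obtain ⟨f, rfl⟩ := AdjoinRoot.mk_surjective r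
  have h1 : ∀ i, (f %ₘ chi a).eval (a i) = 0 := by
    intro i
    have h2 := congrFun hr i
    rw [rootEval_mk, ← modByMonic_add_div f (chi a), eval_add, eval_mul, eval_chi,
      zero_mul, add_zero] at h2
    exact h2
  have h3 : f %ₘ chi a = 0 := by
    refine eq_zero_of_natDegree_lt_card_of_eval_eq_zero _ ha h1 ?_
    rw [Fintype.card_fin]
    conv_rhs => rw [← natDegree_chi a]
    refine natDegree_modByMonic_lt _ (chi_monic a) fun h => ?_
    have := natDegree_chi a
    rw [h, natDegree_one] at this
    omega
  rw [AdjoinRoot.mk_eq_zero]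
  exact (modByMonic_eq_zero_iff_dvd (chi_monic a)).1 h3

/-- The index of `ℤ[x] / (χ)` in `ℤⁿ` is the absolute value of the Vandermonde determinant. -/
theorem index_range_rootEval (ha : Function.Injective a) :
    (rootEval a).range.toAddSubgroup.index = (Delta a).natAbs := by
  classical
  let f : RootOrder a →ₗ[ℤ] (Fin n → ℤ) := (rootEval a).toAddMonoidHom.toIntLinearMap
  have hf : Function.Injective f := rootEval_injective ha
  have hd : (AdjoinRoot.powerBasis' (chi_monic a)).dim = n := by
    rw [AdjoinRoot.powerBasis'_dim, natDegree_chi]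
  let b := (AdjoinRoot.powerBasis' (chi_monic a)).basis.reindex (finCongr hd)
  let b' : Module.Basis (Fin n) ℤ (LinearMap.range f) := b.map (LinearEquiv.ofInjective f hf)
  have h := Submodule.natAbs_det_basis_change (Pi.basisFun ℤ (Fin n)) (LinearMap.range f) b'
  have h1 : (Pi.basisFun ℤ (Fin n)).toMatrix ((↑) ∘ b') = Matrix.vandermonde a := by
    ext i j
    have h2 : b j = AdjoinRoot.mk (chi a) (X ^ (j : ℕ)) := by
      rw [map_pow, AdjoinRoot.mk_X]
      simp [b]
    change rootEval a (b j) i = _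
    rw [h2, rootEval_mk]
    simp [Matrix.vandermonde]
  rw [Module.Basis.det_apply, h1, Matrix.det_vandermonde] at h
  exact h.symm

theorem Delta_pos (ha : StrictMono a) : 0 < Delta a :=
  Finset.prod_pos fun _ _ => Finset.prod_pos fun _ hj =>
    sub_pos.2 (ha (Finset.mem_Ioi.1 hj))

/-- A quotient group is annihilated by its order, here the index `Δ`. -/
theorem exists_rootEval_eq (ha : StrictMono a) (z : Fin n → ℤ) :
    ∃ r, rootEval a r = ((Delta a).toNat : Fin n → ℤ) * z := by
  have h := AddSubgroup.nsmul_index_mem (rootEval a).range.toAddSubgroup z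
  rw [index_range_rootEval ha.injective, nsmul_eq_mul] at h
  have h2 : (Delta a).toNat = (Delta a).natAbs := by have := Delta_pos ha; omega
  rw [h2]
  exact h

/-- The extension of a ring homomorphism to `ℤⁿ` to the total algebra. -/
def extendRat {R : Type} [CommRing R] (φ : R →+* (Fin n → ℤ)) : TotalAlgebra R →ₐ[ℚ] (Fin n → ℚ) :=
  (Algebra.TensorProduct.lift (Algebra.ofId ℚ (Fin n → ℚ))
    { ((Int.castRingHom ℚ).compLeft (Fin n)).comp φ with commutes' := fun z => by simp }
    fun _ _ => Commute.all _ _ : ℚ ⊗[ℤ] R →ₐ[ℚ] (Fin n → ℚ))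

theorem extendRat_algebraMap {R : Type} [CommRing R] (φ : R →+* (Fin n → ℤ)) (r : R) (i : Fin n) :
    extendRat φ (algebraMap _ _ r) i = (φ r i : ℚ) := by
  have h := Algebra.TensorProduct.lift_tmul (Algebra.ofId ℚ (Fin n → ℚ))
    ({ ((Int.castRingHom ℚ).compLeft (Fin n)).comp φ with commutes' := fun z => by simp } :
      R →ₐ[ℤ] (Fin n → ℚ)) (fun _ _ => Commute.all _ _) (1 : ℚ) r
  rw [map_one, one_mul] at h
  exact congrFun h i

theorem exists_natCast_mul_eq (q : Fin n → ℚ) :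
    ∃ d : ℕ, d ≠ 0 ∧ ∃ z : Fin n → ℤ, ∀ i, (d : ℚ) * q i = z i := by
  refine ⟨∏ i, (q i).den, Finset.prod_ne_zero_iff.2 fun i _ => (q i).den_nz,
    fun i => (∏ j ∈ Finset.univ.erase i, ((q j).den : ℤ)) * (q i).num, fun i => ?_⟩
  rw [← Finset.mul_prod_erase _ _ (Finset.mem_univ i)]
  push_cast
  rw [mul_right_comm, Rat.den_mul_eq_num, mul_comm]

/-- Denominators are cleared twice, by `d` into `ℤⁿ` and by `Δ` into `R`, which gives surjectivity;
equal dimensions give the rest. -/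
theorem extendRat_rootEval_bijective (ha : StrictMono a) :
    Function.Bijective (extendRat (rootEval a)) := by
  have hsurj : Function.Surjective (extendRat (rootEval a)) := by
    intro q
    obtain ⟨d, hd, z, hz⟩ := exists_natCast_mul_eq q
    obtain ⟨r, hr⟩ := exists_rootEval_eq ha z
    have hm : ((Delta a).toNat : ℚ) ≠ 0 := by
      have := Delta_pos ha
      exact_mod_cast (by omega : (Delta a).toNat ≠ 0)
    have hd' : (d : ℚ) ≠ 0 := by exact_mod_cast hd
    refine ⟨((Delta a).toNat * d : ℚ)⁻¹ • algebraMap _ _ r, ?_⟩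
    rw [map_smul]
    funext i
    rw [Pi.smul_apply, extendRat_algebraMap, hr, smul_eq_mul]
    simp only [Pi.mul_apply, Pi.natCast_apply, Int.cast_mul, Int.cast_natCast, ← hz]
    field_simp
  refine ⟨?_, hsurj⟩
  have h : Module.finrank ℚ (TotalAlgebra (RootOrder a)) = Module.finrank ℚ (Fin n → ℚ) := by
    rw [finrank_total, Module.finrank_fin_fun]
  exact (LinearMap.injective_iff_surjective_of_finrank_eq_finrank
    (f := (extendRat (rootEval a)).toLinearMap) h).2 hsurj

/-- `ℤ[x] / (χ)` as an order in `ℤⁿ`. -/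
def rootSplitOrder (ha : StrictMono a) : SplitOrder (RootOrder a) n (Delta a).toNat where
  ev := rootEval a
  emb := ((AlgEquiv.ofBijective _ (extendRat_rootEval_bijective ha)).symm :
    (Fin n → ℚ) →+* TotalAlgebra (RootOrder a)).comp ((Int.castRingHom ℚ).compLeft (Fin n))
  emb_injective z w h := by
    have h1 := (AlgEquiv.ofBijective _ (extendRat_rootEval_bijective ha)).symm.injective h
    exact funext fun i => Int.cast_injective (congrFun h1 i)
  algebraMap_eq r := by
    refine (extendRat_rootEval_bijective ha).1 ?_
    refine Eq.trans ?_ (AlgEquiv.apply_symm_apply (AlgEquiv.ofBijective _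
      (extendRat_rootEval_bijective ha)) _).symm
    funext i
    exact extendRat_algebraMap _ r i
  conductor := exists_rootEval_eq ha
  exists_denominator k := by
    obtain ⟨d, hd, z, hz⟩ := exists_natCast_mul_eq (extendRat (rootEval a) k)
    refine ⟨d, hd, z, ?_⟩
    refine (extendRat_rootEval_bijective ha).1 ?_
    refine Eq.trans ?_ (AlgEquiv.apply_symm_apply (AlgEquiv.ofBijective _
      (extendRat_rootEval_bijective ha)) _).symm
    rw [map_mul, map_natCast]
    funext i
    exact hz i

@[simp]
theorem rootSplitOrder_ev (ha : StrictMono a) : (rootSplitOrder ha).ev = rootEval a := rfl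

end RootOrder

/-! ### Counting residue units -/

/-- Every fibre is a coset of the kernel. The set `s` is arbitrary because units are to be counted
through an additive map. -/
theorem card_preimage_of_surjective {G H : Type*} [AddGroup G] [AddGroup H] [Finite G]
    (f : G →+ H) (hf : Function.Surjective f) (s : Set H) :
    Nat.card (f ⁻¹' s) = Nat.card f.ker * Nat.card s := by
  have hfib : ∀ y : s, Nat.card {x : f ⁻¹' s // (⟨f x, x.2⟩ : s) = y} = Nat.card f.ker := by
    rintro ⟨y, hy⟩
    obtain ⟨g, rfl⟩ := hf y
    refine Nat.card_congr
      { toFun := fun x => ⟨x.1.1 - g, by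
          have := congrArg Subtype.val x.2
          rw [AddMonoidHom.mem_ker, map_sub]
          exact sub_eq_zero.2 this⟩
        invFun := fun k => ⟨⟨k.1 + g, by
          rw [Set.mem_preimage, map_add, k.2, zero_add]; exact hy⟩,
          Subtype.ext (by
            change f (k.1 + g) = f g
            rw [map_add, k.2, zero_add])⟩
        left_inv := fun x => Subtype.ext (Subtype.ext (by simp))
        right_inv := fun k => Subtype.ext (by simp) }
  have : Finite H := Finite.of_surjective f hf
  have : Fintype s := Fintype.ofFinite _
  rw [← Nat.card_congr (Equiv.sigmaFiberEquiv fun x : f ⁻¹' s => (⟨f x, x.2⟩ : s)), Nat.card_sigma]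
  simp only [hfib]
  rw [Finset.sum_const, Finset.card_univ, smul_eq_mul, mul_comm, Nat.card_eq_fintype_card (α := s)]

section Residues

variable {n : ℕ} (a : Fin n → ℤ)

/-- The residues of the roots modulo `p`. -/
def rootResidues (p : ℕ) : Finset (ZMod p) := Finset.univ.image fun i => (a i : ZMod p)

/-- A root with a given residue modulo `p`. -/
def rootIndex {p : ℕ} (c : rootResidues a p) : Fin n := (Finset.mem_image.1 c.2).choose

theorem cast_rootIndex {p : ℕ} (c : rootResidues a p) : (a (rootIndex a c) : ZMod p) = c :=
  (Finset.mem_image.1 c.2).choose_spec.2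

theorem cast_eval {p : ℕ} (f : ℤ[X]) (x : ℤ) :
    ((f.eval x : ℤ) : ZMod p) = (f.map (Int.castRingHom (ZMod p))).eval (x : ZMod p) := by
  simp

/-- Integer polynomials take prescribed residues at finitely many points modulo each of finitely
many primes. -/
theorem exists_eval_eq {s : Finset ℕ} (hs : ∀ p ∈ s, p.Prime) (S : ∀ p : s, Finset (ZMod p))
    (t : ∀ p : s, S p → ZMod p) :
    ∃ f : ℤ[X], ∀ (p : s) (c : S p) (x : ℤ), (x : ZMod p) = c → ((f.eval x : ℤ) : ZMod p) = t p c := by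
  classical
  have hg : ∀ p : s, ∃ g : ℤ[X], ∀ (c : S p) (x : ℤ), (x : ZMod p) = c →
      ((g.eval x : ℤ) : ZMod p) = t p c := by
    intro p
    have : Fact (p : ℕ).Prime := ⟨hs p p.2⟩
    -- One prime at a time: Lagrange interpolation over `ZMod p`, lifted to `ℤ`. The integers `e`
    -- below glue the primes together.
    obtain ⟨g, hg⟩ := map_surjective (Int.castRingHom (ZMod p)) ZMod.intCast_surjective
      (Lagrange.interpolate Finset.univ (fun c : S p => (c : ZMod p)) (t p))
    refine ⟨g, fun c x hx => ?_⟩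
    rw [cast_eval, hg, hx]
    exact Lagrange.eval_interpolate_at_node (v := fun c : S p => (c : ZMod p)) (t p)
      Subtype.val_injective.injOn (Finset.mem_univ c)
  choose g hg using hg
  have hcop : Pairwise (Function.onFun IsCoprime fun p : s => Ideal.span {((p : ℕ) : ℤ)}) := by
    intro p q hpq
    rw [Function.onFun, Ideal.isCoprime_span_singleton_iff, Nat.isCoprime_iff_coprime]
    exact (Nat.coprime_primes (hs p p.2) (hs q q.2)).2 fun h => hpq (Subtype.ext h)
  choose e he using fun q : s =>
    Ideal.exists_forall_sub_mem_ideal hcop (fun p => if p = q then (1 : ℤ) else 0)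
  have he' : ∀ q p : s, ((e q : ℤ) : ZMod p) = if p = q then 1 else 0 := by
    intro q p
    have h := Ideal.mem_span_singleton.1 (he q p)
    rw [← ZMod.intCast_zmod_eq_zero_iff_dvd, Int.cast_sub, sub_eq_zero] at h
    rw [h]
    split_ifs <;> simp
  refine ⟨∑ q, C (e q) * g q, fun p c x hx => ?_⟩
  rw [eval_finsetSum, Int.cast_sum, Finset.sum_eq_single p]
  · rw [eval_mul, eval_C, Int.cast_mul, he', if_pos rfl, one_mul, hg p c x hx]
  · intro q _ hq
    rw [eval_mul, eval_C, Int.cast_mul, he', if_neg hq.symm, zero_mul]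
  · simp

theorem isUnit_intCast_iff {m : ℕ} (hm : m ≠ 0) (z : ℤ) :
    IsUnit (z : ZMod m) ↔ ∀ p ∈ m.primeFactors, (z : ZMod p) ≠ 0 := by
  rw [ZMod.coe_int_isUnit_iff_isCoprime, Int.isCoprime_iff_gcd_eq_one]
  simp only [ne_eq, ZMod.intCast_zmod_eq_zero_iff_dvd]
  change Nat.gcd (m : ℤ).natAbs z.natAbs = 1 ↔ _
  rw [Int.natAbs_natCast]
  constructor
  · intro h p hp hpz
    have hp' := Nat.mem_primeFactors.1 hp
    exact Nat.not_coprime_of_dvd_of_dvd hp'.1.one_lt hp'.2.1 (Int.natCast_dvd.1 hpz) h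
  · intro h
    refine Nat.coprime_of_dvd fun p hp hpm hpz => ?_
    exact h p (Nat.mem_primeFactors.2 ⟨hp, hpm, hm⟩) (Int.natCast_dvd.2 hpz)

variable (m : ℕ)

/-- Reduction modulo the primes dividing `m`, at the distinct residues of the roots. -/
def residueMap : (Fin n → ZMod m) →+
    ∀ p : m.primeFactors, rootResidues a (p : ℕ) → ZMod (p : ℕ) where
  toFun x p c := ZMod.castHom (Nat.dvd_of_mem_primeFactors p.2) (ZMod (p : ℕ)) (x (rootIndex a c))
  map_zero' := by funext p c; simp
  map_add' x y := by funext p c; exact map_add _ _ _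

/-- The image of `ℤ[x] / (χ)` in `(ℤ/m)ⁿ`. -/
def residueRing : Subring (Fin n → ZMod m) := ((reduction n m).comp (rootEval a)).range

theorem residueMap_reduction (z : Fin n → ℤ) (p : m.primeFactors) (c : rootResidues a (p : ℕ)) :
    residueMap a m (reduction n m z) p c = (z (rootIndex a c) : ZMod (p : ℕ)) := by
  exact map_intCast (ZMod.castHom (Nat.dvd_of_mem_primeFactors p.2) (ZMod (p : ℕ))) _

theorem residueMap_surjective :
    Function.Surjective ((residueMap a m).comp (residueRing a m).toAddSubgroup.subtype) := by
  intro t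
  obtain ⟨f, hf⟩ := exists_eval_eq (fun p hp => Nat.prime_of_mem_primeFactors hp)
    (fun p : m.primeFactors => rootResidues a (p : ℕ)) t
  refine ⟨⟨_, ⟨AdjoinRoot.mk (chi a) f, rfl⟩⟩, ?_⟩
  funext p c
  refine (residueMap_reduction a m _ p c).trans ?_
  rw [rootEval_mk]
  exact hf p c _ (cast_rootIndex a c)

/-- Modulo `p` the value `f(a_i)` depends only on `a_i` modulo `p`, so one root per residue
suffices. For `x` outside `residueRing` the untested coordinates would be unconstrained. -/
theorem isUnit_iff_residueMap (hm : m ≠ 0) {x : Fin n → ZMod m} (hx : x ∈ residueRing a m) :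
    IsUnit x ↔ ∀ p c, residueMap a m x p c ≠ 0 := by
  obtain ⟨r, rfl⟩ := hx
  obtain ⟨f, rfl⟩ := AdjoinRoot.mk_surjective r
  rw [Pi.isUnit_iff]
  have h1 : ∀ p c, residueMap a m (((reduction n m).comp (rootEval a)) (AdjoinRoot.mk (chi a) f)) p c
      = ((f.eval (a (rootIndex a c)) : ℤ) : ZMod (p : ℕ)) := fun p c => by
    rw [RingHom.comp_apply, residueMap_reduction, rootEval_mk]
  have h2 : ∀ i, ((reduction n m).comp (rootEval a)) (AdjoinRoot.mk (chi a) f) i =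
      ((f.eval (a i) : ℤ) : ZMod m) := fun i => by
    rw [RingHom.comp_apply, reduction_apply, rootEval_mk]
  simp only [h1, h2, isUnit_intCast_iff hm]
  constructor
  · exact fun h p c => h _ p p.2
  · intro h i p hp
    have := h ⟨p, hp⟩ ⟨(a i : ZMod p), Finset.mem_image_of_mem _ (Finset.mem_univ i)⟩
    rwa [cast_eval, cast_rootIndex, ← cast_eval] at this

theorem card_residueMap_ne_zero :
    Nat.card {t : ∀ p : m.primeFactors, rootResidues a (p : ℕ) → ZMod (p : ℕ) | ∀ p c, t p c ≠ 0} =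
      ∏ p ∈ m.primeFactors, (p - 1) ^ (rootResidues a p).card := by
  have e : {t : ∀ p : m.primeFactors, rootResidues a (p : ℕ) → ZMod (p : ℕ) | ∀ p c, t p c ≠ 0} ≃
      ∀ p : m.primeFactors, rootResidues a (p : ℕ) → {x : ZMod (p : ℕ) // x ≠ 0} :=
    { toFun := fun t p c => ⟨t.1 p c, t.2 p c⟩
      invFun := fun t => ⟨fun p c => (t p c).1, fun p c => (t p c).2⟩
      left_inv := fun _ => rfl
      right_inv := fun _ => rfl }
  rw [Nat.card_congr e, Nat.card_pi,
    ← Finset.prod_coe_sort m.primeFactors fun p => (p - 1) ^ (rootResidues a p).card]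
  refine Finset.prod_congr rfl fun p _ => ?_
  have : Fact (p : ℕ).Prime := ⟨Nat.prime_of_mem_primeFactors p.2⟩
  rw [Nat.card_fun, Nat.card_eq_fintype_card, Fintype.card_subtype_compl, ZMod.card,
    Fintype.card_subtype_eq, Nat.card_eq_fintype_card, Fintype.card_coe]

theorem card_residueMap_target :
    Nat.card (∀ p : m.primeFactors, rootResidues a (p : ℕ) → ZMod (p : ℕ)) =
      ∏ p ∈ m.primeFactors, p ^ (rootResidues a p).card := by
  rw [Nat.card_pi, ← Finset.prod_coe_sort m.primeFactors fun p => p ^ (rootResidues a p).card]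
  refine Finset.prod_congr rfl fun p _ => ?_
  rw [Nat.card_fun, Nat.card_zmod, Nat.card_eq_fintype_card, Fintype.card_coe]

end Residues

/-! ### The class number as an Euler product -/

section Count

variable {n : ℕ} {a : Fin n → ℤ}

theorem toNat_Delta_ne_zero (ha : StrictMono a) : (Delta a).toNat ≠ 0 := by
  have := Delta_pos ha
  omega

/-- The preimage of `residueRing` in `ℤⁿ` is the order itself, so its index in `(ℤ/m)ⁿ` is again
`Δ`. -/
theorem card_residueRing (ha : StrictMono a) :
    Nat.card (residueRing a (Delta a).toNat) * (Delta a).toNat = (Delta a).toNat ^ n := by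
  set m := (Delta a).toNat with hm
  have hcomap : (residueRing a m).toAddSubgroup.comap (reduction n m : (Fin n → ℤ) →+ _) =
      (rootEval a).range.toAddSubgroup := by
    ext z
    exact ((rootSplitOrder ha).exists_ev_eq_iff (z := z)).symm
  have h1 := AddSubgroup.index_comap_of_surjective (residueRing a m).toAddSubgroup
    (f := (reduction n m : (Fin n → ℤ) →+ (Fin n → ZMod m))) (reduction_surjective n m)
  rw [hcomap, index_range_rootEval ha.injective] at h1
  have h2 := (residueRing a m).toAddSubgroup.card_mul_index
  have h3 : (Delta a).natAbs = m := by have := Delta_pos ha; omega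
  rw [← h1, h3, Nat.card_fun, Nat.card_zmod, Nat.card_fin] at h2
  exact h2

/-- `residueMap` is onto with fibres of equal size, so the proportion of units in `residueRing` is
that of nowhere-zero vectors in the target. -/
theorem card_residueUnits_mul (ha : StrictMono a) [NeZero (Delta a).toNat] :
    Nat.card (rootSplitOrder ha).residueUnits * ∏ p ∈ (Delta a).toNat.primeFactors,
        p ^ (rootResidues a p).card =
      Nat.card (residueRing a (Delta a).toNat) * ∏ p ∈ (Delta a).toNat.primeFactors,
        (p - 1) ^ (rootResidues a p).card := by
  set m := (Delta a).toNat with hm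
  let f := (residueMap a m).comp (residueRing a m).toAddSubgroup.subtype
  have hf : Function.Surjective f := residueMap_surjective a m
  have h1 := card_preimage_of_surjective f hf {t | ∀ p c, t p c ≠ 0}
  have h2 := card_preimage_of_surjective f hf Set.univ
  rw [card_residueMap_ne_zero] at h1
  rw [Set.preimage_univ, Nat.card_congr (Equiv.Set.univ _), Nat.card_congr (Equiv.Set.univ _),
    card_residueMap_target] at h2
  have h3 : Nat.card (rootSplitOrder ha).residueUnits = Nat.card (f ⁻¹' {t | ∀ p c, t p c ≠ 0}) := by
    refine Nat.card_congr (Equiv.ofBijective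
      (fun u => ⟨⟨((u : (Fin n → ZMod m)ˣ) : Fin n → ZMod m), u.2⟩, ?_⟩) ⟨?_, ?_⟩)
    · exact (isUnit_iff_residueMap a m (NeZero.ne m) u.2).1 u.1.isUnit
    · intro u v huv
      exact Subtype.ext (Units.ext (congrArg (fun x => (x.1.1 : Fin n → ZMod m)) huv))
    · rintro ⟨⟨x, hx⟩, hx'⟩
      obtain ⟨u, hu⟩ := (isUnit_iff_residueMap a m (NeZero.ne m) hx).2 hx'
      subst hu
      exact ⟨⟨u, hx⟩, rfl⟩
  rw [h3, h1]
  have h4 : Nat.card (residueRing a m) = Nat.card (residueRing a m).toAddSubgroup := rfl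
  rw [h4, h2]
  ring

theorem card_rootResidues_pos (hn : n ≠ 0) (a : Fin n → ℤ) (p : ℕ) :
    0 < (rootResidues a p).card :=
  Finset.card_pos.2 ⟨_, Finset.mem_image_of_mem _ (Finset.mem_univ ⟨0, Nat.pos_of_ne_zero hn⟩)⟩

/-- A prime divides `Δ` if and only if two roots agree modulo `p`. -/
theorem dvd_Delta_iff (ha : StrictMono a) {p : ℕ} (hp : p.Prime) :
    p ∣ (Delta a).toNat ↔ (rootResidues a p).card < n := by
  have h0 : ((Delta a).toNat : ℤ) = Delta a := Int.toNat_of_nonneg (Delta_pos ha).le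
  rw [← Int.natCast_dvd_natCast, h0]
  have hp' : Prime (p : ℤ) := Nat.prime_iff_prime_int.1 hp
  have hle : (rootResidues a p).card ≤ n := Finset.card_image_le.trans (by simp)
  rw [lt_iff_le_and_ne, and_iff_right hle]
  have hinj : (rootResidues a p).card = n ↔ Function.Injective fun i => (a i : ZMod p) := by
    have := Finset.card_image_iff (s := Finset.univ) (f := fun i => (a i : ZMod p))
    rw [Finset.card_univ, Fintype.card_fin, Finset.coe_univ, Set.injOn_univ] at this
    exact this
  rw [Ne, hinj, Delta, hp'.dvd_finsetProd_iff]
  have hdvd : ∀ i j, (p : ℤ) ∣ a j - a i ↔ (a i : ZMod p) = a j := fun i j =>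
    (ZMod.intCast_eq_intCast_iff_dvd_sub _ _ _).symm
  constructor
  · rintro ⟨i, _, hi⟩ h
    obtain ⟨j, hj, hd⟩ := (hp'.dvd_finsetProd_iff _).1 hi
    exact (Finset.mem_Ioi.1 hj).ne (h ((hdvd i j).1 hd))
  · intro h
    rw [Function.Injective] at h
    push Not at h
    obtain ⟨i, j, hij, hne⟩ := h
    rcases lt_or_gt_of_ne hne with h1 | h1
    · exact ⟨i, Finset.mem_univ _, (hp'.dvd_finsetProd_iff _).2
        ⟨j, Finset.mem_Ioi.2 h1, (hdvd i j).2 hij⟩⟩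
    · exact ⟨j, Finset.mem_univ _, (hp'.dvd_finsetProd_iff _).2
        ⟨i, Finset.mem_Ioi.2 h1, (hdvd j i).2 hij.symm⟩⟩

/-- The normalized class number as a product over the primes dividing `Δ`. -/
theorem normalizedClassNumber_eq (hn : n ≠ 0) (ha : StrictMono a) :
    normalizedClassNumber a = (Nat.card (rootSplitOrder ha).orderUnits : ℝ) / 2 *
      ∏ p ∈ (Delta a).toNat.primeFactors,
        (1 - (p : ℝ)⁻¹) ^ (n - 1 - (rootResidues a p).card) := by
  have : NeZero (Delta a).toNat := ⟨toNat_Delta_ne_zero ha⟩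
  set m := (Delta a).toNat with hm
  have hm0 : m ≠ 0 := toNat_Delta_ne_zero ha
  have hmR : (m : ℝ) ≠ 0 := by exact_mod_cast hm0
  have hpos : ∀ p ∈ m.primeFactors, (1 - (p : ℝ)⁻¹) ≠ 0 := fun p hp => by
    have h2 : (1 : ℝ) < p := by exact_mod_cast (Nat.prime_of_mem_primeFactors hp).one_lt
    have := inv_lt_one_of_one_lt₀ h2
    linarith
  set Q : (ℕ → ℕ) → ℝ := fun e => ∏ p ∈ m.primeFactors, (1 - (p : ℝ)⁻¹) ^ e p with hQ
  have hQ0 : ∀ e, Q e ≠ 0 := fun e => Finset.prod_ne_zero_iff.2 fun p hp => pow_ne_zero _ (hpos p hp)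
  have hφ : (m.totient : ℝ) = m * Q fun _ => 1 := by
    have := congrArg (Rat.cast : ℚ → ℝ) (Nat.totient_eq_mul_prod_factors m)
    simp only [hQ, pow_one]
    push_cast at this
    exact this
  have hA : (Nat.card (Fin n → ZMod m)ˣ : ℝ) = (m : ℝ) ^ n * Q fun _ => n := by
    rw [Nat.card_congr MulEquiv.piUnits.toEquiv, Nat.card_pi, Finset.prod_const, Finset.card_univ,
      Fintype.card_fin, Nat.card_eq_fintype_card, ZMod.card_units_eq_totient, Nat.cast_pow, hφ,
      mul_pow]
    simp only [hQ, pow_one, Finset.prod_pow]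
  have hB : (Nat.card (rootSplitOrder ha).residueUnits : ℝ) * m =
      (m : ℝ) ^ n * Q fun p => (rootResidues a p).card := by
    have h1 := card_residueUnits_mul ha
    have h2 := card_residueRing ha
    have h3 : ((∏ p ∈ m.primeFactors, (p - 1) ^ (rootResidues a p).card : ℕ) : ℝ) =
        (∏ p ∈ m.primeFactors, p ^ (rootResidues a p).card : ℕ) *
          Q fun p => (rootResidues a p).card := by
      simp only [hQ]
      push_cast
      rw [← Finset.prod_mul_distrib]
      refine Finset.prod_congr rfl fun p hp => ?_
      have hp' := Nat.prime_of_mem_primeFactors hp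
      rw [← mul_pow, Nat.cast_sub hp'.one_lt.le, mul_sub, mul_inv_cancel₀
        (by exact_mod_cast hp'.ne_zero), mul_one, Nat.cast_one]
    have h4 : ((∏ p ∈ m.primeFactors, p ^ (rootResidues a p).card : ℕ) : ℝ) ≠ 0 := by
      exact_mod_cast Finset.prod_ne_zero_iff.2 fun p hp =>
        pow_ne_zero _ (Nat.prime_of_mem_primeFactors hp).ne_zero
    have h1' := congrArg (Nat.cast : ℕ → ℝ) h1
    have h2' := congrArg (Nat.cast : ℕ → ℝ) h2
    rw [Nat.cast_mul, Nat.cast_mul, h3] at h1'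
    push_cast at h2'
    rw [← h2']
    refine mul_right_cancel₀ h4 ?_
    linear_combination (m : ℝ) * h1'
  -- For `p ∣ Δ` there are at most `n - 1` residues, so the subtraction in the last exponent is not
  -- truncated.
  have hexp : (Q fun _ => n) = (Q fun _ => 1) * ((Q fun p => (rootResidues a p).card) *
      Q fun p => n - 1 - (rootResidues a p).card) := by
    simp only [hQ]
    rw [← Finset.prod_mul_distrib, ← Finset.prod_mul_distrib]
    refine Finset.prod_congr rfl fun p hp => ?_
    have := (dvd_Delta_iff ha (Nat.prime_of_mem_primeFactors hp)).1 (Nat.dvd_of_mem_primeFactors hp)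
    rw [← pow_add, ← pow_add]
    congr 1
    omega
  have hcl : (Nat.card (IdealClassGroup (RootOrder a)) : ℝ) *
      (2 ^ n * Nat.card (rootSplitOrder ha).residueUnits) =
      Nat.card (Fin n → ZMod m)ˣ * Nat.card (rootSplitOrder ha).orderUnits := by
    exact_mod_cast (rootSplitOrder ha).card_idealClassGroup_mul
  rw [hA, hexp] at hcl
  have hB0 : (Nat.card (rootSplitOrder ha).residueUnits : ℝ) ≠ 0 := by
    intro h
    rw [h, zero_mul, eq_comm] at hB
    exact mul_ne_zero (pow_ne_zero _ hmR) (hQ0 _) hB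
  have h2n : (2 : ℝ) ^ n = 2 ^ (n - 1) * 2 := by
    rw [← pow_succ, Nat.sub_add_cancel (Nat.pos_of_ne_zero hn)]
  change (Nat.card (IdealClassGroup (RootOrder a)) : ℝ) * 2 ^ (n - 1) / (m.totient : ℝ) =
    (Nat.card (rootSplitOrder ha).orderUnits : ℝ) / 2 * Q fun p => n - 1 - (rootResidues a p).card
  rw [hφ, div_eq_iff (mul_ne_zero hmR (hQ0 _))]
  refine mul_right_cancel₀ (mul_ne_zero hB0 two_ne_zero) ?_
  rw [h2n] at hcl
  linear_combination hcl - (Nat.card (rootSplitOrder ha).orderUnits : ℝ) * (Q fun _ => 1) *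
    (Q fun p => n - 1 - (rootResidues a p).card) * hB

end Count

/-! ### Asymptotics -/

section Asymptotics

variable {n : ℕ} {a : Fin n → ℤ}

/-- The constant `4` is twice the largest distance `2` between roots at which a unit of `R` takes
opposite signs. -/
theorem Delta_le_of_sub_le (ha : StrictMono a) (h : ∀ i j, a j - a i ≤ 4) :
    Delta a ≤ 4 ^ (n * n) := by
  calc Delta a ≤ ∏ _i : Fin n, (4 : ℤ) ^ n := by
        refine Finset.prod_le_prod
          (fun i _ => Finset.prod_nonneg fun j hj => (sub_pos.2 (ha (Finset.mem_Ioi.1 hj))).le)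
          fun i _ => ?_
        calc ∏ j ∈ Finset.Ioi i, (a j - a i) ≤ ∏ _j ∈ Finset.Ioi i, (4 : ℤ) :=
              Finset.prod_le_prod (fun j hj => (sub_pos.2 (ha (Finset.mem_Ioi.1 hj))).le)
                fun j _ => h i j
          _ ≤ 4 ^ n := by
              rw [Finset.prod_const]
              refine pow_le_pow_right₀ (by norm_num) ?_
              exact (Finset.card_le_univ _).trans (by simp)
    _ = 4 ^ (n * n) := by
        rw [Finset.prod_const, Finset.card_univ, Fintype.card_fin, ← pow_mul]

theorem sub_dvd_Delta {i j : Fin n} (hij : i < j) : a j - a i ∣ Delta a :=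
  (Finset.dvd_prod_of_mem (fun j => a j - a i) (Finset.mem_Ioi.2 hij)).trans
    (Finset.dvd_prod_of_mem (fun i => ∏ j ∈ Finset.Ioi i, (a j - a i)) (Finset.mem_univ i))

/-- If the roots are not all close together, then `±1` are the only units of `ℤ[x] / (χ)`. -/
theorem card_orderUnits (hn : n ≠ 0) (ha : StrictMono a) (hΔ : 4 ^ (n * n) < Delta a) :
    Nat.card (rootSplitOrder ha).orderUnits = 2 := by
  let i₀ : Fin n := ⟨0, Nat.pos_of_ne_zero hn⟩
  rw [Nat.card_eq_two_iff]
  refine ⟨1, ⟨-1, -1, by simp⟩, fun h => ?_, ?_⟩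
  · have := congrFun (congrArg
      (fun u : (rootSplitOrder ha).orderUnits => ((u : (Fin n → ℤ)ˣ) : Fin n → ℤ)) h) i₀
    norm_num at this
  · rw [Set.eq_univ_iff_forall]
    rintro ⟨w, r, hr⟩
    obtain ⟨f, rfl⟩ := AdjoinRoot.mk_surjective r
    have hf : ∀ i, f.eval (a i) = (w : Fin n → ℤ) i := fun i => by
      rw [← hr, rootSplitOrder_ev, rootEval_mk]
    have hw : ∀ i, (w : Fin n → ℤ) i = 1 ∨ (w : Fin n → ℤ) i = -1 := fun i =>
      Int.isUnit_iff.1 (w.isUnit.map (Pi.evalRingHom (fun _ => ℤ) i))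
    have hne : ∀ i j, (w : Fin n → ℤ) i ≠ (w : Fin n → ℤ) j → |a i - a j| ≤ 2 := by
      intro i j hij
      have h1 : a i - a j ∣ (w : Fin n → ℤ) i - (w : Fin n → ℤ) j := by
        rw [← hf, ← hf]
        exact sub_dvd_eval_sub _ _ f
      have h2 : a i - a j ∣ 2 := by
        rcases hw i with hi | hi <;> rcases hw j with hj | hj <;> rw [hi, hj] at h1 hij
        · exact absurd rfl hij
        · simpa using h1
        · simpa using (dvd_neg.2 h1)
        · exact absurd rfl hij
      exact Int.le_of_dvd two_pos ((abs_dvd _ _).2 h2)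
    have hconst : ∀ i, (w : Fin n → ℤ) i = (w : Fin n → ℤ) i₀ := by
      by_contra! hcon
      obtain ⟨k, hk⟩ := hcon
      refine absurd hΔ (not_lt.2 (Delta_le_of_sub_le ha fun i j => ?_))
      -- Two roots of equal sign are compared through a root of the opposite sign, which is `k` or
      -- `i₀`.
      have htri : ∀ l, (w : Fin n → ℤ) i ≠ (w : Fin n → ℤ) l →
          (w : Fin n → ℤ) j ≠ (w : Fin n → ℤ) l → a j - a i ≤ 4 := fun l h1 h2 => by
        have h3 := abs_le.1 (hne i l h1)
        have h4 := abs_le.1 (hne j l h2)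
        linarith [h3.1, h4.2]
      by_cases hij : (w : Fin n → ℤ) i = (w : Fin n → ℤ) j
      · by_cases h : (w : Fin n → ℤ) i = (w : Fin n → ℤ) i₀
        · exact htri k (by rw [h]; exact hk.symm) (by rw [← hij, h]; exact hk.symm)
        · exact htri i₀ h (by rwa [← hij])
      · have := abs_le.1 (hne i j hij)
        linarith [this.1]
    rcases hw i₀ with h | h
    · left
      exact Subtype.ext (Units.ext (funext fun i => (hconst i).trans h))
    · right
      exact Subtype.ext (Units.ext (funext fun i => (hconst i).trans h))

theorem normalizedClassNumber_eq_prod (hn : n ≠ 0) (ha : StrictMono a)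
    (hΔ : 4 ^ (n * n) < Delta a) :
    normalizedClassNumber a = ∏ p ∈ (Delta a).toNat.primeFactors,
      (1 - (p : ℝ)⁻¹) ^ (n - 1 - (rootResidues a p).card) := by
  rw [normalizedClassNumber_eq hn ha, card_orderUnits hn ha hΔ]
  norm_num

theorem eventually_normalizedClassNumber_eq (hn : n ≠ 0) :
    ∀ᶠ a : {a : Fin n → ℤ // StrictMono a} in deltaToInfinity n,
      normalizedClassNumber a.1 = ∏ p ∈ (Delta a.1).toNat.primeFactors,
        (1 - (p : ℝ)⁻¹) ^ (n - 1 - (rootResidues a.1 p).card) := by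
  have h : ∀ᶠ a : {a : Fin n → ℤ // StrictMono a} in deltaToInfinity n,
      4 ^ (n * n) < Delta a.1 := tendsto_comap.eventually (eventually_gt_atTop _)
  exact h.mono fun a ha => normalizedClassNumber_eq_prod hn a.2 ha

theorem one_sub_inv_nonneg {p : ℕ} (hp : p.Prime) : 0 ≤ 1 - (p : ℝ)⁻¹ :=
  sub_nonneg.2 (inv_le_one_of_one_le₀ (by exact_mod_cast hp.one_lt.le))

theorem one_sub_inv_le_one (p : ℕ) : 1 - (p : ℝ)⁻¹ ≤ 1 :=
  sub_le_self _ (by positivity)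

/-- Dropping factors and decreasing exponents increases the Euler product. -/
theorem prod_pow_le_prod_pow {s t : Finset ℕ} (hst : s ⊆ t) (ht : ∀ p ∈ t, p.Prime) {e e' : ℕ → ℕ}
    (he : ∀ p ∈ s, e p ≤ e' p) :
    ∏ p ∈ t, (1 - (p : ℝ)⁻¹) ^ e' p ≤ ∏ p ∈ s, (1 - (p : ℝ)⁻¹) ^ e p := by
  rw [← Finset.prod_sdiff hst]
  calc (∏ p ∈ t \ s, (1 - (p : ℝ)⁻¹) ^ e' p) * ∏ p ∈ s, (1 - (p : ℝ)⁻¹) ^ e' p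
      ≤ 1 * ∏ p ∈ s, (1 - (p : ℝ)⁻¹) ^ e' p := by
        refine mul_le_mul_of_nonneg_right ?_ (Finset.prod_nonneg fun p hp =>
          pow_nonneg (one_sub_inv_nonneg (ht p (hst hp))) _)
        exact Finset.prod_le_one
          (fun p hp => pow_nonneg (one_sub_inv_nonneg (ht p (Finset.mem_sdiff.1 hp).1)) _)
          fun p hp => pow_le_one₀ (one_sub_inv_nonneg (ht p (Finset.mem_sdiff.1 hp).1))
            (one_sub_inv_le_one p)
    _ ≤ _ := by
        rw [one_mul]
        exact Finset.prod_le_prod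
          (fun p hp => pow_nonneg (one_sub_inv_nonneg (ht p (hst hp))) _)
          fun p hp => pow_le_pow_of_le_one (one_sub_inv_nonneg (ht p (hst hp)))
            (one_sub_inv_le_one p) (he p hp)

theorem card_rootResidues_le (a : Fin n → ℤ) {p : ℕ} (hp : p.Prime) :
    (rootResidues a p).card ≤ p := by
  have : Fact p.Prime := ⟨hp⟩
  exact (Finset.card_le_univ _).trans (ZMod.card p).le

/-- There are at most `p` residues modulo `p`, which bounds the exponents from below; for `p ≤ n -
2` two of the `n` roots must agree modulo `p`, so `p ∣ Δ`. -/
theorem prod_primeFactors_le (ha : StrictMono a) :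
    ∏ p ∈ (Delta a).toNat.primeFactors, (1 - (p : ℝ)⁻¹) ^ (n - 1 - (rootResidues a p).card) ≤
      ∏ p ∈ (Finset.Icc 1 (n - 2)).filter Nat.Prime, (1 - (p : ℝ)⁻¹) ^ (n - 1 - p) := by
  refine prod_pow_le_prod_pow (fun p hp => ?_) (fun p => Nat.prime_of_mem_primeFactors) ?_
  · obtain ⟨hp1, hp⟩ := Finset.mem_filter.1 hp
    have h1 := (Finset.mem_Icc.1 hp1)
    have h2 := card_rootResidues_le a hp
    exact Nat.mem_primeFactors.2 ⟨hp, (dvd_Delta_iff ha hp).2 (by omega), toNat_Delta_ne_zero ha⟩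
  · intro p hp
    have := card_rootResidues_le a (Finset.mem_filter.1 hp).2
    omega

/-- The integers `0, 1, …, n - 2` followed by the large integer `n + N`. -/
def consecutiveThenLarge (n N : ℕ) (i : Fin n) : ℤ := if (i : ℕ) + 1 = n then n + N else i

theorem strictMono_consecutiveThenLarge (n N : ℕ) : StrictMono (consecutiveThenLarge n N) := by
  intro i j hij
  have h1 : (i : ℕ) < j := hij
  have h2 := j.2
  unfold consecutiveThenLarge
  split_ifs <;> omega

theorem le_Delta_consecutiveThenLarge (hn : 2 ≤ n) (N : ℕ) :
    (N : ℤ) ≤ Delta (consecutiveThenLarge n N) := by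
  let i : Fin n := ⟨0, by omega⟩
  let j : Fin n := ⟨n - 1, by omega⟩
  have h1 := Int.le_of_dvd (Delta_pos (strictMono_consecutiveThenLarge n N))
    (sub_dvd_Delta (i := i) (j := j) (Fin.mk_lt_mk.2 (by omega)))
  have h2 : consecutiveThenLarge n N i = 0 := by
    simp [consecutiveThenLarge, i]; omega
  have h3 : consecutiveThenLarge n N j = n + N := by
    simp [consecutiveThenLarge, j]; omega
  rw [h2, h3] at h1
  omega

/-- The roots `0, …, n - 2` alone supply these residues, whatever the last root is. -/
theorem min_le_card_rootResidues (hn : 2 ≤ n) (N p : ℕ) :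
    min p (n - 1) ≤ (rootResidues (consecutiveThenLarge n N) p).card := by
  calc min p (n - 1) = ((Finset.range (min p (n - 1))).image fun k : ℕ => (k : ZMod p)).card := by
        rw [Finset.card_image_of_injOn, Finset.card_range]
        intro k hk l hl hkl
        have hk' := lt_min_iff.1 (Finset.mem_range.1 hk)
        have hl' := lt_min_iff.1 (Finset.mem_range.1 hl)
        exact Nat.ModEq.eq_of_lt_of_lt ((ZMod.natCast_eq_natCast_iff _ _ _).1 hkl) hk'.1 hl'.1
    _ ≤ _ := by
        refine Finset.card_le_card fun c hc => ?_
        obtain ⟨k, hk, rfl⟩ := Finset.mem_image.1 hc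
        have hk' := lt_min_iff.1 (Finset.mem_range.1 hk)
        refine Finset.mem_image.2 ⟨⟨k, by omega⟩, Finset.mem_univ _, ?_⟩
        rw [consecutiveThenLarge, if_neg (by simp; omega)]
        simp

theorem le_prod_consecutiveThenLarge (hn : 2 ≤ n) (N : ℕ) :
    ∏ p ∈ (Finset.Icc 1 (n - 2)).filter Nat.Prime, (1 - (p : ℝ)⁻¹) ^ (n - 1 - p) ≤
      ∏ p ∈ (Delta (consecutiveThenLarge n N)).toNat.primeFactors,
        (1 - (p : ℝ)⁻¹) ^ (n - 1 - (rootResidues (consecutiveThenLarge n N) p).card) := by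
  set s := (Delta (consecutiveThenLarge n N)).toNat.primeFactors
  -- Primes above `n - 2` can be adjoined freely, since their truncated exponent `n - 1 - p` is
  -- zero.
  have h : ∏ p ∈ (Finset.Icc 1 (n - 2)).filter Nat.Prime, (1 - (p : ℝ)⁻¹) ^ (n - 1 - p) =
      ∏ p ∈ (Finset.Icc 1 (n - 2)).filter Nat.Prime ∪ s, (1 - (p : ℝ)⁻¹) ^ (n - 1 - p) := by
    refine Finset.prod_subset Finset.subset_union_left fun p hp hp' => ?_
    have hps : p.Prime := by
      rcases Finset.mem_union.1 hp with h | h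
      · exact absurd h hp'
      · exact Nat.prime_of_mem_primeFactors h
    have h1 : ¬ p ≤ n - 2 := fun h => hp' (Finset.mem_filter.2
      ⟨Finset.mem_Icc.2 ⟨hps.one_lt.le, h⟩, hps⟩)
    rw [show n - 1 - p = 0 by omega, pow_zero]
  rw [h]
  refine prod_pow_le_prod_pow Finset.subset_union_right (fun p hp => ?_) fun p _ => ?_
  · rcases Finset.mem_union.1 hp with h | h
    · exact (Finset.mem_filter.1 h).2
    · exact Nat.prime_of_mem_primeFactors h
  · have := min_le_card_rootResidues hn N p
    omega

/-- The arithmetic progression `0, k!, 2 k!, …, (n - 1) k!`. -/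
def factorialProgression (n k : ℕ) (i : Fin n) : ℤ := i * k.factorial

theorem strictMono_factorialProgression (n k : ℕ) : StrictMono (factorialProgression n k) := by
  intro i j hij
  have h1 : ((i : ℕ) : ℤ) < (j : ℕ) := by exact_mod_cast hij
  have h2 : (0 : ℤ) < k.factorial := by exact_mod_cast k.factorial_pos
  exact mul_lt_mul_of_pos_right h1 h2

theorem factorial_dvd_Delta (hn : 2 ≤ n) (k : ℕ) :
    (k.factorial : ℤ) ∣ Delta (factorialProgression n k) := by
  have h := sub_dvd_Delta (a := factorialProgression n k) (i := ⟨0, by omega⟩) (j := ⟨1, by omega⟩)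
    (Fin.mk_lt_mk.2 one_pos)
  simpa [factorialProgression] using h

theorem le_Delta_factorialProgression (hn : 2 ≤ n) (k : ℕ) :
    (k : ℤ) ≤ Delta (factorialProgression n k) := by
  have h1 := Int.le_of_dvd (Delta_pos (strictMono_factorialProgression n k))
    (factorial_dvd_Delta hn k)
  have h2 : (k : ℤ) ≤ k.factorial := by exact_mod_cast k.self_le_factorial
  exact h2.trans h1

/-- All roots vanish modulo a prime `p < k`, so the exponent there is at least `n - 2 ≥ 1`; the
remaining factors are at most `1`. -/
theorem prod_factorialProgression_le (hn : 3 ≤ n) (k : ℕ) :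
    ∏ p ∈ (Delta (factorialProgression n k)).toNat.primeFactors,
        (1 - (p : ℝ)⁻¹) ^ (n - 1 - (rootResidues (factorialProgression n k) p).card) ≤
      ∏ p ∈ (Finset.range k).filter Nat.Prime, (1 - (p : ℝ)⁻¹) := by
  have hdvd : ∀ p ∈ (Finset.range k).filter Nat.Prime, (p : ℤ) ∣ k.factorial := fun p hp => by
    have h1 := Finset.mem_filter.1 hp
    exact_mod_cast h1.2.dvd_factorial.2 (Finset.mem_range.1 h1.1).le
  have h := prod_pow_le_prod_pow (s := (Finset.range k).filter Nat.Prime)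
    (t := (Delta (factorialProgression n k)).toNat.primeFactors)
    (e := fun _ => 1) (e' := fun p => n - 1 - (rootResidues (factorialProgression n k) p).card)
    (fun p hp => ?_) (fun p => Nat.prime_of_mem_primeFactors) (fun p hp => ?_)
  · simpa using h
  · refine Nat.mem_primeFactors.2 ⟨(Finset.mem_filter.1 hp).2, ?_,
      toNat_Delta_ne_zero (strictMono_factorialProgression n k)⟩
    rw [← Int.natCast_dvd_natCast,
      Int.toNat_of_nonneg (Delta_pos (strictMono_factorialProgression n k)).le]
    exact (hdvd p hp).trans (factorial_dvd_Delta (by omega) k)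
  · have h1 : rootResidues (factorialProgression n k) p ⊆ {0} := by
      intro c hc
      obtain ⟨i, _, rfl⟩ := Finset.mem_image.1 hc
      rw [Finset.mem_singleton, ZMod.intCast_zmod_eq_zero_iff_dvd]
      exact (hdvd p hp).mul_left _
    have h2 := Finset.card_le_card h1
    rw [Finset.card_singleton] at h2
    change 1 ≤ n - 1 - (rootResidues (factorialProgression n k) p).card
    omega

/-- Mertens' product over the primes tends to zero. -/
theorem tendsto_prod_one_sub_inv_primes :
    Tendsto (fun k => ∏ p ∈ (Finset.range k).filter Nat.Prime, (1 - (p : ℝ)⁻¹)) atTop (nhds 0) := by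
  have h1 : Tendsto (fun k => ∑ p ∈ Finset.range k,
      Set.indicator {p | Nat.Prime p} (fun n : ℕ => (1 : ℝ) / n) p) atTop atTop :=
    (not_summable_iff_tendsto_nat_atTop_of_nonneg fun p =>
      Set.indicator_nonneg (fun _ _ => by positivity) _).1 not_summable_one_div_on_primes
  -- The bound `1 - 1/p ≤ exp (-1/p)` compares the product with the exponential of minus the
  -- divergent sum of `1/p`.
  refine squeeze_zero (fun k => Finset.prod_nonneg fun p hp =>
    one_sub_inv_nonneg (Finset.mem_filter.1 hp).2) (fun k => ?_)
    (Real.tendsto_exp_neg_atTop_nhds_zero.comp h1)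
  rw [Function.comp_apply, ← Finset.sum_neg_distrib, Real.exp_sum, Finset.prod_filter]
  refine Finset.prod_le_prod (fun p _ => ?_) fun p _ => ?_
  · split_ifs with h
    · exact one_sub_inv_nonneg h
    · exact zero_le_one
  · split_ifs with h
    · rw [Set.indicator_of_mem (show p ∈ {p | Nat.Prime p} from h), one_div]
      have := Real.add_one_le_exp (-(p : ℝ)⁻¹)
      linarith
    · rw [Set.indicator_of_notMem (show p ∉ {p | Nat.Prime p} from h)]
      simp

/-! ### Finiteness and the limits along `Δ → ∞` -/

theorem tendsto_deltaToInfinity {g : ℕ → {a : Fin n → ℤ // StrictMono a}}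
    (hg : ∀ k : ℕ, (k : ℤ) ≤ Delta (g k).1) : Tendsto g atTop (deltaToInfinity n) :=
  tendsto_comap_iff.2 (tendsto_atTop_mono hg tendsto_natCast_atTop_atTop)

theorem finite_idealClassGroup_rootOrder (ha : StrictMono a) :
    Finite (IdealClassGroup (RootOrder a)) := by
  have : NeZero (Delta a).toNat := ⟨toNat_Delta_ne_zero ha⟩
  exact (rootSplitOrder ha).finite_idealClassGroup

theorem tendsto_consecutiveThenLarge (hn : 2 ≤ n) :
    Tendsto (fun N => (⟨consecutiveThenLarge n N, strictMono_consecutiveThenLarge n N⟩ :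
      {a : Fin n → ℤ // StrictMono a})) atTop (deltaToInfinity n) :=
  tendsto_deltaToInfinity (le_Delta_consecutiveThenLarge hn)

/-- There is always at least one residue, so every exponent `2 - 1 - r_p` is zero and the ratio is
eventually exactly `1`. -/
theorem liminf_normalizedClassNumber_two :
    liminf (fun a : {a : Fin 2 → ℤ // StrictMono a} => (normalizedClassNumber a.1 : EReal))
      (deltaToInfinity 2) = 1 := by
  have : (deltaToInfinity 2).NeBot := (tendsto_consecutiveThenLarge le_rfl).neBot
  have h : ∀ᶠ a : {a : Fin 2 → ℤ // StrictMono a} in deltaToInfinity 2,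
      (normalizedClassNumber a.1 : EReal) = 1 := by
    filter_upwards [eventually_normalizedClassNumber_eq two_ne_zero] with a ha
    rw [ha, Finset.prod_eq_one, EReal.coe_one]
    intro p _
    have := card_rootResidues_pos two_ne_zero a.1 p
    rw [show 2 - 1 - (rootResidues a.1 p).card = 0 by omega, pow_zero]
  rw [liminf_congr h, liminf_const]

theorem liminf_normalizedClassNumber (hn : 3 ≤ n) :
    liminf (fun a : {a : Fin n → ℤ // StrictMono a} => (normalizedClassNumber a.1 : EReal))
      (deltaToInfinity n) = 0 := by
  have hF := tendsto_deltaToInfinity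
    (g := fun k => ⟨factorialProgression n k, strictMono_factorialProgression n k⟩)
    (le_Delta_factorialProgression (by omega))
  have hnonneg : ∀ a : Fin n → ℤ, 0 ≤ normalizedClassNumber a := fun a => by
    unfold normalizedClassNumber
    positivity
  have hlim : Tendsto (fun k => normalizedClassNumber (factorialProgression n k)) atTop
      (nhds 0) := by
    refine squeeze_zero' (Eventually.of_forall fun k => hnonneg _) ?_ tendsto_prod_one_sub_inv_primes
    filter_upwards [hF.eventually (eventually_normalizedClassNumber_eq (by omega))] with k hk
    rw [hk]
    exact prod_factorialProgression_le hn k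
  refine le_antisymm ?_ (le_liminf_of_le (h := Eventually.of_forall fun a =>
    EReal.coe_nonneg.2 (hnonneg a.1)))
  -- Passing to the family of progressions refines the filter, which can only raise the liminf.
  refine (liminf_le_liminf_of_le hF).trans ?_
  have h : Tendsto (fun k => (normalizedClassNumber (factorialProgression n k) : EReal)) atTop
      (nhds ((0 : ℝ) : EReal)) := (continuous_coe_real_ereal.tendsto 0).comp hlim
  exact h.liminf_eq.le

theorem limsup_normalizedClassNumber (hn : 2 ≤ n) :
    limsup (fun a : {a : Fin n → ℤ // StrictMono a} => (normalizedClassNumber a.1 : EReal))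
      (deltaToInfinity n) = ((∏ p ∈ (Finset.Icc 1 (n - 2)).filter Nat.Prime,
          (1 - (p : ℝ)⁻¹) ^ (n - 1 - p) : ℝ) : EReal) := by
  have hev := eventually_normalizedClassNumber_eq (n := n) (by omega)
  have hL := tendsto_consecutiveThenLarge hn
  refine le_antisymm (limsup_le_of_le (h := ?_)) (le_limsup_of_frequently_le (hL.frequently
    (Eventually.frequently ?_)))
  · filter_upwards [hev] with a ha
    rw [EReal.coe_le_coe_iff, ha]
    exact prod_primeFactors_le a.2
  · filter_upwards [hL.eventually hev] with N hN
    rw [EReal.coe_le_coe_iff, hN]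
    exact le_prod_consecutiveThenLarge hn N

end Asymptotics

end OrderClassGroup

end

theorem theorem1p2 (n : ℕ) (hn : 2 ≤ n) :
    (∀ a : Fin n → ℤ, StrictMono a →
      Finite (OrderClassGroup.IdealClassGroup (OrderClassGroup.RootOrder a))) ∧
    liminf (fun a : {a : Fin n → ℤ // StrictMono a} =>
        (OrderClassGroup.normalizedClassNumber a.1 : EReal)) (OrderClassGroup.deltaToInfinity n)
      = (if n = 2 then 1 else 0) ∧
    limsup (fun a : {a : Fin n → ℤ // StrictMono a} =>
        (OrderClassGroup.normalizedClassNumber a.1 : EReal)) (OrderClassGroup.deltaToInfinity n)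
      = ((∏ p ∈ (Finset.Icc 1 (n - 2)).filter Nat.Prime,
          (1 - (p : ℝ)⁻¹) ^ (n - 1 - p) : ℝ) : EReal) := by
  refine ⟨fun a => OrderClassGroup.finite_idealClassGroup_rootOrder, ?_,
    OrderClassGroup.limsup_normalizedClassNumber hn⟩
  split_ifs with h
  · subst h
    exact OrderClassGroup.liminf_normalizedClassNumber_two
  · exact OrderClassGroup.liminf_normalizedClassNumber (by omega)
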